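/- **Definitions.** Let $\mathbb{T}=\mathbb{R}/\mathbb{Z}$ and let $d\ge 1$ be an integer. A sequence $(c_n)_{n\ge 0}$ of complex numbers is *oscillating of order $d$* if $$\lim_{N\to\infty}\frac1N\sum_{n=0}^{N-1}c_n e^{2\pi i P(n)}=0$$ for every real polynomial $P$ of degree at most $d$. It is *linearly disjoint* from a dynamical system $(X,T)$ ($X$ a compact metric space, $T:X\to X$ continuous) if $$\lim_{N\to\infty}\frac1N\sum_{n=0}^{N-1}c_n f(T^n x)=0$$ for every $x\in X$ and every continuous $f:X\to\mathbb{C}$. "Zero entropy" means zero topological entropy. An affine map of a compact abelian group $X$ is a map $Tx=\sigma x+b$ with $b\in X$ and $\sigma$ a (topological group) automorphism of $X$, called the automorphism part of $T$. For $m\ge1$ and $F$ a finite abelian group, a zero-entropy automorphism of $\mathbb{T}^m\times F$ is *special* if it has the form $(x,y)\mapsto(Ax+By,Cy)$ with $A$ an automorphism of $\mathbb{T}^m$, $B:F\to\mathbb{T}^m$ a homomorphism and $C$ an automorphism of $F$, where $(A-I)^m=0$ and $(A-I)^{m-1}\ne0$. An affine map is special if its automorphism part is special. **Theorem.** Let $d\ge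 1$ and let $(c_n)_{n\ge0}$ be a sequence of complex numbers. Consider the following conditions. 1. $(c_n)$ is linearly disjoint from all zero-entropy automorphisms of $\mathbb{T}^{d+1}\times F$, for all finite abelian groups $F$. 2. $(c_n)$ is linearly disjoint from $\sigma$, where $F$ is any fixed finite abelian group and $\sigma$ any fixed special zero-entropy automorphism of $\mathbb{T}^{d+1}\times F$. 3. $(c_n)$ is linearly disjoint from all zero-entropy affine maps of $\mathbb{T}^{d}\times F$, for all finite abelian groups $F$. 4. $(c_n)$ is linearly disjoint from all zero-entropy affine maps of $\mathbb{T}^{d}\times F$ with automorphism part $\sigma$, where $F$ is any fixed finite abelian group and $\sigma$ any fixed special zero-entropy automorphism of $\mathbb{T}^{d}\times F$. Each of the conditions (1), (2), (3), (4) implies that $(c_n)$ is oscillating of order $d$. Conversely, if $(c_n)$ is oscillating of order $d$ and $$\sup_{N\ge1}\frac1N\sum_{n=0}^{N-1}|c_n|<\infty,$$ then each of (1), (2), (3), (4) holds. In particular, for sequences satisfying this bound, being oscillating of order $d$ is equivalent to each of (1), (2), (3), (4). -/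

import Mathlib

open Filter Topology

universe u

/-- `(c_n)` is oscillating of order `d`: its averages against `e^{2πi P(n)}` tend to `0` for every
real polynomial `P` of degree at most `d`. -/
def IsOscillating (d : ℕ) (c : ℕ → ℂ) : Prop :=
  ∀ P : Polynomial ℝ, P.degree ≤ (d : WithBot ℕ) →
    Tendsto (fun N : ℕ => (1 / (N : ℂ)) * ∑ n ∈ Finset.range N,
      c n * Complex.exp (2 * (Real.pi : ℂ) * Complex.I * ((P.eval (n : ℝ) : ℝ) : ℂ)))
      atTop (𝓝 0)

/-- `(c_n)` is linearly disjoint from the dynamical system `(X, T)`. -/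
def LinearlyDisjoint {X : Type*} [TopologicalSpace X] (c : ℕ → ℂ) (T : X → X) : Prop :=
  ∀ (x : X) (f : C(X, ℂ)),
    Tendsto (fun N : ℕ => (1 / (N : ℂ)) * ∑ n ∈ Finset.range N, c n * f (T^[n] x))
      atTop (𝓝 0)

/-- The means `(1/N) ∑_{n<N} |c_n|` are bounded. -/
def HasBoundedMeans (c : ℕ → ℂ) : Prop :=
  ∃ K : ℝ, ∀ N : ℕ, 1 ≤ N → (1 / (N : ℝ)) * ∑ n ∈ Finset.range N, ‖c n‖ ≤ K

/-- `T` has zero topological entropy (Bowen's definition through dynamical covers, on the whole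
space). -/
def HasZeroEntropy {X : Type*} [UniformSpace X] (T : X → X) : Prop :=
  Dynamics.coverEntropy T Set.univ = 0

/-- The compact abelian group `𝕋^m × F`. -/
abbrev TorusProd (m : ℕ) (F : Type u) : Type u := UnitAddTorus (Fin m) × F

/-- The affine map `z ↦ σ z + b`, with automorphism part `σ`. -/
def affineMap {X : Type*} [TopologicalSpace X] [AddCommGroup X] (σ : X ≃ₜ+ X) (b : X) : X → X :=
  fun z => σ z + b

/-- The endomorphism `A - I`, where `A` is an automorphism; powers of it are iterates. -/
def subOne {X : Type*} [TopologicalSpace X] [AddCommGroup X] (A : X ≃ₜ+ X) : AddMonoid.End X :=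
  let A' : AddMonoid.End X := A.toAddEquiv.toAddMonoidHom
  A' - 1

/-- An automorphism of `𝕋^m × F` is special if it has the form `(x, y) ↦ (A x + B y, C y)`, with
`A` an automorphism of `𝕋^m`, `B` a morphism from `F` to `𝕋^m` and `C` an automorphism of `F`, and
if `A - I` is nilpotent of order exactly `m`. -/
def IsSpecial {m : ℕ} {F : Type u} [AddCommGroup F] [TopologicalSpace F]
    (σ : TorusProd m F ≃ₜ+ TorusProd m F) : Prop :=
  ∃ (A : UnitAddTorus (Fin m) ≃ₜ+ UnitAddTorus (Fin m)) (B : F →+ UnitAddTorus (Fin m))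
    (C : F ≃+ F),
    (∀ x y, σ (x, y) = (A x + B y, C y)) ∧ subOne A ^ m = 0 ∧ subOne A ^ (m - 1) ≠ 0

/-- `(c_n)` is linearly disjoint from all automorphisms of zero entropy of `𝕋^m × F`, for all finite
abelian groups `F` (with the discrete topology). -/
def DisjointFromAutomorphisms (m : ℕ) (c : ℕ → ℂ) : Prop :=
  ∀ (F : Type u) [AddCommGroup F] [Finite F] [UniformSpace F] [DiscreteTopology F]
    (σ : TorusProd m F ≃ₜ+ TorusProd m F),
    HasZeroEntropy (σ : TorusProd m F → TorusProd m F) →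
      LinearlyDisjoint c (σ : TorusProd m F → TorusProd m F)

/-- `(c_n)` is linearly disjoint from all affine maps of zero entropy of `𝕋^m × F`, for all finite
abelian groups `F` (with the discrete topology). -/
def DisjointFromAffineMaps (m : ℕ) (c : ℕ → ℂ) : Prop :=
  ∀ (F : Type u) [AddCommGroup F] [Finite F] [UniformSpace F] [DiscreteTopology F]
    (σ : TorusProd m F ≃ₜ+ TorusProd m F) (b : TorusProd m F),
    HasZeroEntropy (affineMap σ b) → LinearlyDisjoint c (affineMap σ b)

/-- `(c_n)` is linearly disjoint from all affine maps of zero entropy with automorphism part `σ`. -/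
def DisjointFromAffineMapsOver {m : ℕ} {F : Type u} [AddCommGroup F] [UniformSpace F]
    (c : ℕ → ℂ) (σ : TorusProd m F ≃ₜ+ TorusProd m F) : Prop :=
  ∀ b : TorusProd m F, HasZeroEntropy (affineMap σ b) → LinearlyDisjoint c (affineMap σ b)

/-! Along an orbit of an affine map `T` with linear part `τ`, the difference of order `j + 1` at
time `k` is `τ^k (τ - 1)^j (T x - x)`. If `τ` is unipotent, these differences eventually vanish, and
Newton's formula turns every character of the torus, read along the orbit, into a polynomial phase.
Unipotency of order `d` gives degree at most `d` for an affine map. For an automorphism `T x - x =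
(τ - 1) x` saves one difference, so order `d + 1` again gives degree `d`.

From oscillation to disjointness, zero entropy must force a power of the map to be unipotent. The
toral part lifts to an integer matrix. An eigenvalue of modulus above 1 would stretch a segment
exponentially and produce exponentially many separated orbits (`le_coverMincard`,
`HasZeroEntropy.not_exponential_growth`). So all eigenvalues have modulus at most 1, and by
Kronecker they are roots of unity. Further powers fix the finite component and bring the nilpotency
order down to `m` (`HasZeroEntropy.exists_unipotent_power`). Passing to a power means restricting
`c` to residue classes, whose indicators are averages of linear phases; these are harmless because
`d ≥ 1`. Characters span a dense subspace, and bounded means extend the conclusion to all continuous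
functions.

Conversely, for a special automorphism some coordinate of `(A - I)^(m-1)` is a nonzero character,
hence surjective. The Newton coefficients along an orbit can then be prescribed one by one
(`exists_prescribed_chain`), so every polynomial phase occurs exactly along some orbit and no bound
on `c` is needed. For the two conditions quantified over all maps, a special automorphism of zero
entropy must also exist: a unipotent shift, whose polynomial growth gives zero entropy. -/

open scoped Uniformity SetRel

/-! ### Weighted averages tending to zero -/

/-- The averages of `w` tend to zero. -/
def MeanZero (w : ℕ → ℂ) : Prop :=
  Tendsto (fun N : ℕ => (1 / (N : ℂ)) * ∑ n ∈ Finset.range N, w n) atTop (𝓝 0)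

namespace MeanZero

theorem zero : MeanZero fun _ => 0 := by
  simp [MeanZero]

theorem add {v w : ℕ → ℂ} (hv : MeanZero v) (hw : MeanZero w) : MeanZero fun n => v n + w n := by
  have h := Tendsto.add hv hw
  simpa only [MeanZero, Finset.sum_add_distrib, mul_add, add_zero] using h

theorem const_mul {w : ℕ → ℂ} (a : ℂ) (hw : MeanZero w) : MeanZero fun n => a * w n := by
  have h := Tendsto.const_mul a hw
  simpa only [MeanZero, ← Finset.mul_sum, mul_left_comm, mul_zero] using h

theorem sum {ι : Type*} {s : Finset ι} {w : ι → ℕ → ℂ} (hw : ∀ i ∈ s, MeanZero (w i)) :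
    MeanZero fun n => ∑ i ∈ s, w i n := by
  classical
  induction s using Finset.induction_on with
  | empty => simpa using zero
  | insert i s hi ih =>
    simp only [Finset.sum_insert hi]
    exact (hw i (by simp)).add (ih fun j hj => hw j (by simp [hj]))

/-- For a weight with bounded means, the functions whose averages along a fixed sequence tend to
zero form a closed subspace. -/
theorem of_dense_span {X : Type*} [TopologicalSpace X] [CompactSpace X] {c : ℕ → ℂ}
    (hc : HasBoundedMeans c) (u : ℕ → X) {S : Set C(X, ℂ)}
    (hS : (Submodule.span ℂ S).topologicalClosure = ⊤)
    (h : ∀ f ∈ S, MeanZero fun n => c n * f (u n)) (f : C(X, ℂ)) :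
    MeanZero fun n => c n * f (u n) := by
  have hspan : ∀ g ∈ Submodule.span ℂ S, MeanZero fun n => c n * g (u n) := by
    intro g hg
    induction hg using Submodule.span_induction with
    | mem g hg => exact h g hg
    | zero => simpa using zero
    | add g₁ g₂ _ _ h₁ h₂ => simpa [mul_add] using h₁.add h₂
    | smul a g _ hg => simpa [mul_left_comm] using hg.const_mul a
  obtain ⟨K, hK⟩ := hc
  have hK0 : 0 ≤ K := le_trans (by positivity) (hK 1 le_rfl)
  rw [MeanZero, Metric.tendsto_atTop]
  intro ε hε
  have hf : f ∈ closure (Submodule.span ℂ S : Set C(X, ℂ)) := by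
    rw [← Submodule.topologicalClosure_coe, hS]
    trivial
  -- `K + 1` replaces `K` because `K` may be zero.
  obtain ⟨g, hg, hfg⟩ := Metric.mem_closure_iff.1 hf (ε / (2 * (K + 1))) (by positivity)
  obtain ⟨N₀, hN₀⟩ := Metric.tendsto_atTop.1 (hspan g hg) (ε / 2) (by positivity)
  refine ⟨max N₀ 1, fun N hN => ?_⟩
  have h₁ := hN₀ N (le_of_max_le_left hN)
  have hN1 : 1 ≤ N := le_of_max_le_right hN
  rw [dist_zero_right] at h₁ ⊢
  have hsplit : (1 / (N : ℂ)) * ∑ n ∈ Finset.range N, c n * f (u n) =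
      (1 / (N : ℂ)) * ∑ n ∈ Finset.range N, c n * (f - g) (u n) +
      (1 / (N : ℂ)) * ∑ n ∈ Finset.range N, c n * g (u n) := by
    rw [← mul_add, ← Finset.sum_add_distrib]
    simp [mul_sub]
  have h₂ : ‖(1 / (N : ℂ)) * ∑ n ∈ Finset.range N, c n * (f - g) (u n)‖ ≤ K * ‖f - g‖ := by
    calc ‖(1 / (N : ℂ)) * ∑ n ∈ Finset.range N, c n * (f - g) (u n)‖
        ≤ (1 / (N : ℝ)) * ∑ n ∈ Finset.range N, ‖c n‖ * ‖f - g‖ := by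
          rw [norm_mul]
          simp only [norm_div, norm_one, Complex.norm_natCast]
          gcongr
          refine (norm_sum_le _ _).trans (Finset.sum_le_sum fun n _ => ?_)
          rw [norm_mul]
          gcongr
          exact (f - g).norm_coe_le_norm (u n)
      _ = ((1 / (N : ℝ)) * ∑ n ∈ Finset.range N, ‖c n‖) * ‖f - g‖ := by
          rw [← Finset.sum_mul, mul_assoc]
      _ ≤ K * ‖f - g‖ := by gcongr; exact hK N hN1
  have h₃ : K * ‖f - g‖ ≤ ε / 2 := by
    rw [dist_eq_norm] at hfg
    calc K * ‖f - g‖ ≤ (K + 1) * (ε / (2 * (K + 1))) := by gcongr; linarith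
      _ = ε / 2 := by field_simp
  rw [hsplit]
  exact (norm_add_le _ _).trans_lt (by linarith)

end MeanZero

/-! ### Exponentials and residue classes -/

/-- The exponential `e^{2πi t}`. -/
theorem fourier_one_coe (t : ℝ) :
    fourier 1 (t : UnitAddCircle) = Complex.exp (2 * (Real.pi : ℂ) * Complex.I * (t : ℂ)) := by
  rw [fourier_coe_apply]
  simp

theorem fourier_one_add (x y : UnitAddCircle) :
    (fourier 1 (x + y) : ℂ) = fourier 1 x * fourier 1 y := by
  simp [AddCircle.toCircle_add]

theorem isOscillating_iff {d : ℕ} {c : ℕ → ℂ} : IsOscillating d c ↔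
    ∀ P : Polynomial ℝ, P.natDegree ≤ d →
      MeanZero fun n => c n * fourier 1 ((P.eval (n : ℝ) : ℝ) : UnitAddCircle) := by
  simp only [IsOscillating, MeanZero, fourier_one_coe, Polynomial.natDegree_le_iff_degree_le]

/-- The indicator of a residue class as an average of exponentials. -/
theorem indicator_residue_eq {q r : ℕ} (hq : 0 < q) (hr : r < q) (n : ℕ) :
    (if n % q = r then (1 : ℂ) else 0) = (1 / (q : ℂ)) * ∑ j ∈ Finset.range q,
      fourier 1 (((j : ℝ) / q * ((n : ℝ) - r) : ℝ) : UnitAddCircle) := by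
  have hq' : (q : ℂ) ≠ 0 := by exact_mod_cast hq.ne'
  -- The sum is geometric in the `q`-th root of unity `ζ`, which equals 1 exactly when `n ≡ r` mod
  -- `q`.
  set ζ : ℂ := Complex.exp (2 * Real.pi * Complex.I * (((n : ℤ) - (r : ℤ) : ℤ) / (q : ℂ))) with hζ
  have hpow : ∀ j : ℕ, fourier 1 (((j : ℝ) / q * ((n : ℝ) - r) : ℝ) : UnitAddCircle) = ζ ^ j := by
    intro j
    rw [fourier_one_coe, hζ, ← Complex.exp_nat_mul]
    congr 1
    push_cast
    ring
  simp only [hpow]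
  by_cases h : n % q = r
  · have hdvd : (q : ℤ) ∣ (n : ℤ) - r := by
      refine ⟨((n / q : ℕ) : ℤ), ?_⟩
      have := Nat.div_add_mod n q
      rw [h] at this
      rw [sub_eq_iff_eq_add]
      exact_mod_cast this.symm
    obtain ⟨t, ht⟩ := hdvd
    have hone : ζ = 1 := by
      rw [hζ, ht, Complex.exp_eq_one_iff]
      refine ⟨t, ?_⟩
      push_cast
      field_simp
    simp [h, hone, hq']
  · have hne : ζ ≠ 1 := by
      intro hone
      rw [hζ, Complex.exp_eq_one_iff] at hone
      obtain ⟨t, ht⟩ := hone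
      have h2 : (2 * (Real.pi : ℂ) * Complex.I) ≠ 0 := Complex.two_pi_I_ne_zero
      rw [mul_comm (t : ℂ)] at ht
      have h3 := mul_left_cancel₀ h2 ht
      rw [div_eq_iff hq'] at h3
      have h4 : (n : ℤ) - r = t * q := by exact_mod_cast h3
      apply h
      have h5 : (n : ℤ) ≡ (r : ℤ) [ZMOD q] :=
        (Int.modEq_iff_dvd.2 ⟨t, by rw [h4]; ring⟩ : (r : ℤ) ≡ n [ZMOD q]).symm
      have h6 : n ≡ r [MOD q] := (Int.natCast_modEq_iff).1 h5
      rw [h6, Nat.mod_eq_of_lt hr]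
    have hq1 : ζ ^ q = 1 := by
      rw [hζ, ← Complex.exp_nat_mul, Complex.exp_eq_one_iff]
      refine ⟨(n : ℤ) - r, ?_⟩
      field_simp
    rw [if_neg h, geom_sum_eq hne, hq1]
    simp

/-- Oscillation passes to polynomial phases along arithmetic progressions. -/
theorem IsOscillating.meanZero_progression {d : ℕ} {c : ℕ → ℂ} (hd : 1 ≤ d)
    (hc : IsOscillating d c) {q r : ℕ} (hq : 0 < q) (hr : r < q) {P : Polynomial ℝ}
    (hP : P.natDegree ≤ d) :
    MeanZero fun n => (if n % q = r then c n else 0) *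
      fourier 1 ((P.eval ((n / q : ℕ) : ℝ) : ℝ) : UnitAddCircle) := by
  rw [isOscillating_iff] at hc
  -- On the class of `r`, `n / q` is the real number `(n - r) / q`, so `Q` gives the phase there.
  -- The linear terms added in `R j` come from the indicator and keep the degree at most `d` since
  -- `1 ≤ d`.
  let Q : Polynomial ℝ := P.comp (Polynomial.C (1 / (q : ℝ)) * (Polynomial.X - Polynomial.C (r : ℝ)))
  let R : ℕ → Polynomial ℝ := fun j =>
    Q + Polynomial.C ((j : ℝ) / q) * (Polynomial.X - Polynomial.C (r : ℝ))
  have hlin : ∀ a : ℝ, (Polynomial.C a * (Polynomial.X - Polynomial.C (r : ℝ))).natDegree ≤ 1 :=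
    fun a => (Polynomial.natDegree_C_mul_le _ _).trans (Polynomial.natDegree_X_sub_C_le _)
  have hR : ∀ j, (R j).natDegree ≤ d := by
    intro j
    refine Polynomial.natDegree_add_le_of_degree_le ?_ ((hlin _).trans hd)
    refine Polynomial.natDegree_comp_le.trans ?_
    calc _ ≤ d * 1 := Nat.mul_le_mul hP (hlin _)
      _ = d := mul_one d
  have hmain : MeanZero fun n => ∑ j ∈ Finset.range q, (1 / (q : ℂ)) *
      (c n * fourier 1 (((R j).eval (n : ℝ) : ℝ) : UnitAddCircle)) :=
    MeanZero.sum fun j _ => (hc (R j) (hR j)).const_mul _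
  convert hmain using 2 with n
  have hq' : (q : ℝ) ≠ 0 := by exact_mod_cast hq.ne'
  have hind := indicator_residue_eq hq hr n
  have hsum : ∑ j ∈ Finset.range q, (1 / (q : ℂ)) *
      (c n * fourier 1 (((R j).eval (n : ℝ) : ℝ) : UnitAddCircle)) =
      c n * fourier 1 ((Q.eval (n : ℝ) : ℝ) : UnitAddCircle) *
        (if n % q = r then (1 : ℂ) else 0) := by
    rw [hind, Finset.mul_sum, Finset.mul_sum]
    refine Finset.sum_congr rfl fun j _ => ?_
    have : (((R j).eval (n : ℝ) : ℝ) : UnitAddCircle) =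
        ((Q.eval (n : ℝ) : ℝ) : UnitAddCircle) +
          (((j : ℝ) / q * ((n : ℝ) - r) : ℝ) : UnitAddCircle) := by
      rw [← AddCircle.coe_add]
      simp [R]
    rw [this, fourier_one_add]
    ring
  rw [hsum]
  by_cases h : n % q = r
  · have : Q.eval (n : ℝ) = P.eval ((n / q : ℕ) : ℝ) := by
      have h1 : (n : ℝ) = q * (n / q : ℕ) + r := by
        have := Nat.div_add_mod n q
        rw [h] at this
        exact_mod_cast this.symm
      simp only [Q, Polynomial.eval_comp, Polynomial.eval_mul, Polynomial.eval_C,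
        Polynomial.eval_sub, Polynomial.eval_X]
      congr 1
      rw [h1]
      field_simp
      ring
    simp [h, this]
  · simp [h]

theorem HasBoundedMeans.indicator {c : ℕ → ℂ} (hc : HasBoundedMeans c) (p : ℕ → Prop)
    [DecidablePred p] : HasBoundedMeans fun n => if p n then c n else 0 := by
  obtain ⟨K, hK⟩ := hc
  refine ⟨K, fun N hN => le_trans ?_ (hK N hN)⟩
  gcongr with n _
  dsimp only
  split_ifs <;> simp

/-! ### Sequences with vanishing iterated differences -/

/-- A sequence whose differences of order `m` vanish is given by Newton's formula. -/
theorem eq_sum_choose_of_fwdDiff_iter_eq_zero {G : Type*} [AddCommGroup G] {f : ℕ → G} {m : ℕ}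
    (hf : (fwdDiff 1)^[m] f = 0) (n : ℕ) :
    f n = ∑ k ∈ Finset.range m, n.choose k • (fwdDiff 1)^[k] f 0 := by
  have h := shift_eq_sum_fwdDiff_iter 1 f n 0
  rw [zero_add, nsmul_one, Nat.cast_id] at h
  have hz : ∀ k, m ≤ k → (fwdDiff 1)^[k] f = 0 := by
    intro k hk
    obtain ⟨j, rfl⟩ := Nat.exists_eq_add_of_le' hk
    rw [Function.iterate_add_apply, hf]
    induction j with
    | zero => rfl
    | succ j ih => rw [Function.iterate_succ_apply', ih (by omega)]; ext; simp [fwdDiff]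
  rw [h]
  rcases le_total m (n + 1) with hmn | hmn
  · symm
    refine Finset.sum_subset (Finset.range_mono hmn) fun k _ hk => ?_
    rw [hz k (by simpa using hk)]
    simp
  · refine Finset.sum_subset (Finset.range_mono hmn) fun k _ hk => ?_
    rw [Nat.choose_eq_zero_of_lt (by simpa using hk), zero_smul]

/-- The binomial `n.choose k` is the falling factorial of degree `k` divided by `k!`. -/
theorem exists_polynomial_sum_choose (d : ℕ) (a : ℕ → ℝ) :
    ∃ P : Polynomial ℝ, P.natDegree ≤ d ∧
      ∀ n : ℕ, P.eval (n : ℝ) = ∑ k ∈ Finset.range (d + 1), (n.choose k : ℝ) * a k := by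
  refine ⟨∑ k ∈ Finset.range (d + 1), Polynomial.C (a k / k.factorial) * descPochhammer ℝ k, ?_, ?_⟩
  · refine Polynomial.natDegree_sum_le_of_forall_le _ _ fun k hk => ?_
    refine (Polynomial.natDegree_C_mul_le _ _).trans ?_
    rw [descPochhammer_natDegree]
    exact Nat.lt_succ_iff.1 (Finset.mem_range.1 hk)
  · intro n
    rw [Polynomial.eval_finsetSum]
    refine Finset.sum_congr rfl fun k _ => ?_
    rw [Polynomial.eval_mul, Polynomial.eval_C, Nat.cast_choose_eq_descPochhammer_div]
    ring

/-- A sequence in the circle with vanishing differences of order `d + 1` is a polynomial of degree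
at most `d`. -/
theorem exists_polynomial_of_fwdDiff_iter_eq_zero {d : ℕ} {s : ℕ → UnitAddCircle}
    (hs : (fwdDiff 1)^[d + 1] s = 0) :
    ∃ P : Polynomial ℝ, P.natDegree ≤ d ∧ ∀ n : ℕ, s n = ((P.eval (n : ℝ) : ℝ) : UnitAddCircle) := by
  have hlift : ∀ k : ℕ, ∃ a : ℝ, (a : UnitAddCircle) = (fwdDiff 1)^[k] s 0 :=
    fun k => QuotientAddGroup.mk_surjective _
  choose a ha using hlift
  obtain ⟨P, hP, hPn⟩ := exists_polynomial_sum_choose d a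
  refine ⟨P, hP, fun n => ?_⟩
  rw [eq_sum_choose_of_fwdDiff_iter_eq_zero hs n, hPn]
  have := map_sum (QuotientAddGroup.mk' (AddSubgroup.zmultiples (1 : ℝ)))
    (fun k => (n.choose k : ℝ) * a k) (Finset.range (d + 1))
  refine Eq.trans ?_ this.symm
  refine Finset.sum_congr rfl fun k _ => ?_
  rw [← ha, ← nsmul_eq_mul, map_nsmul]
  rfl

/-- Newton's formula for a polynomial at the natural numbers. -/
theorem Polynomial.exists_eval_eq_sum_choose {d : ℕ} {P : Polynomial ℝ} (hP : P.natDegree ≤ d) :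
    ∃ a : ℕ → ℝ, ∀ n : ℕ, P.eval (n : ℝ) = ∑ k ∈ Finset.range (d + 1), n.choose k • a k := by
  have hcomp : ∀ k : ℕ, (fwdDiff 1)^[k] (fun n : ℕ => P.eval (n : ℝ)) =
      fun n : ℕ => (fwdDiff 1)^[k] P.eval (n : ℝ) := by
    intro k
    induction k with
    | zero => rfl
    | succ k ih =>
      rw [Function.iterate_succ_apply', ih, Function.iterate_succ_apply']
      ext n
      simp [fwdDiff]
  refine ⟨fun k => (fwdDiff 1)^[k] (fun n : ℕ => P.eval (n : ℝ)) 0, fun n => ?_⟩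
  refine eq_sum_choose_of_fwdDiff_iter_eq_zero (f := fun n : ℕ => P.eval (n : ℝ)) ?_ n
  rw [hcomp]
  have h := Polynomial.fwdDiff_iter_eq_zero_of_degree_lt (Nat.lt_succ_of_le hP)
  funext n
  exact congrFun h (n : ℝ)

theorem fwdDiff_iter_comp_addMonoidHom {G H : Type*} [AddCommGroup G] [AddCommGroup H]
    (φ : G →+ H) (f : ℕ → G) (k : ℕ) :
    (fwdDiff 1)^[k] (fun n => φ (f n)) = fun n => φ ((fwdDiff 1)^[k] f n) := by
  induction k with
  | zero => rfl
  | succ k ih =>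
    rw [Function.iterate_succ_apply', ih, Function.iterate_succ_apply']
    ext n
    simp [fwdDiff]

/-! ### Orbits of affine maps of abelian groups -/

theorem fwdDiff_iter_end_pow {V : Type*} [AddCommGroup V] (τ : AddMonoid.End V) (w : V) (j : ℕ) :
    (fwdDiff 1)^[j] (fun k : ℕ => (τ ^ k) w) = fun k : ℕ => (τ ^ k) (((τ - 1) ^ j) w) := by
  induction j with
  | zero => rfl
  | succ j ih =>
    rw [Function.iterate_succ_apply', ih]
    ext k
    rw [pow_succ (τ - 1), (Commute.refl (τ - 1)).pow_left j |>.eq]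
    change (τ ^ (k + 1)) (((τ - 1) ^ j) w) - (τ ^ k) (((τ - 1) ^ j) w) =
      (τ ^ k) ((τ - 1) (((τ - 1) ^ j) w))
    rw [pow_succ]
    change (τ ^ k) (τ (((τ - 1) ^ j) w)) - _ = (τ ^ k) (τ _ - _)
    rw [map_sub]
    rfl

/-- Translations cancel in differences. Stating affineness through `hT` lets the result serve for
powers of `T` as well. -/
theorem iterate_sub_iterate {V : Type*} [AddCommGroup V] {τ : AddMonoid.End V} {T : V → V}
    (hT : ∀ x y, T x - T y = τ (x - y)) (k : ℕ) (x y : V) :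
    T^[k] x - T^[k] y = (τ ^ k) (x - y) := by
  induction k with
  | zero => rfl
  | succ k ih =>
    rw [Function.iterate_succ_apply', Function.iterate_succ_apply', hT, ih, pow_succ']
    rfl

/-- Differences along an orbit of an affine map. -/
theorem fwdDiff_iter_orbit {V : Type*} [AddCommGroup V] {τ : AddMonoid.End V} {T : V → V}
    (hT : ∀ x y, T x - T y = τ (x - y)) (j : ℕ) (x : V) :
    (fwdDiff 1)^[j + 1] (fun k : ℕ => T^[k] x) =
      fun k : ℕ => (τ ^ k) (((τ - 1) ^ j) (T x - x)) := by
  rw [Function.iterate_succ_apply, ← fwdDiff_iter_end_pow]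
  congr 1
  ext k
  rw [← iterate_sub_iterate hT, ← Function.iterate_succ_apply T k x]
  rfl

/-- If `1 + ν` is unipotent up to torsion, then one of its powers is unipotent of the expected
order. -/
theorem one_add_pow_sub_one_pow_eq_zero {R : Type*} [Ring R] {ν : R} {e m : ℕ} (hm : m ≠ 0)
    (h₁ : ν ^ (m + 1) = 0) (h₂ : (e : R) * ν ^ m = 0) : ((1 + ν) ^ e - 1) ^ m = 0 := by
  open Polynomial in
  -- Since `(1 + X)^e - 1 = X (e + X t)`, its `m`-th power is `X^m (e + X t)^m`. Expanding one of
  -- the `m ≥ 1` factors puts it in the ideal generated by `e X^m` and `X^(m+1)`.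
  have hpoly : ∃ a b : ℤ[X], ((1 + X) ^ e - 1) ^ m = a * ((e : ℤ[X]) * X ^ m) + b * X ^ (m + 1) := by
    obtain ⟨t, ht⟩ : ∃ t : ℤ[X], (1 + X) ^ e - 1 = X * ((e : ℤ[X]) + X * t) := by
      clear h₂
      induction e with
      | zero => exact ⟨0, by simp⟩
      | succ e ih =>
        obtain ⟨t, ht⟩ := ih
        refine ⟨t + X * t + (e : ℤ[X]), ?_⟩
        rw [pow_succ, sub_eq_iff_eq_add.1 ht]
        push_cast
        ring
    obtain ⟨k, rfl⟩ := Nat.exists_eq_succ_of_ne_zero hm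
    refine ⟨((e : ℤ[X]) + X * t) ^ k, ((e : ℤ[X]) + X * t) ^ k * t, ?_⟩
    rw [ht, Nat.succ_eq_add_one, mul_pow, pow_succ ((e : ℤ[X]) + X * t)]
    ring
  obtain ⟨a, b, hab⟩ := hpoly
  have := congrArg (Polynomial.aeval ν) hab
  simpa [h₁, h₂] using this

/-! ### Oscillation implies disjointness -/

theorem UnitAddTorus.mFourier_apply_eq {m : ℕ} (k : Fin m → ℤ) (x : UnitAddTorus (Fin m)) :
    UnitAddTorus.mFourier k x = fourier 1 (∑ i, k i • x i) := by
  have h : ∀ s : Finset (Fin m), ∏ i ∈ s, (fourier (k i) (x i) : ℂ) =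
      fourier 1 (∑ i ∈ s, k i • x i) := by
    intro s
    induction s using Finset.induction_on with
    | empty => simp
    | insert i s hi ih =>
      rw [Finset.prod_insert hi, Finset.sum_insert hi, fourier_one_add, ih]
      simp [fourier_apply]
  exact h Finset.univ

/-- If along a power of `T` the finite component is fixed and the toral component has vanishing
differences of order `d + 1`, then oscillation of order `d` implies linear disjointness. -/
theorem IsOscillating.linearlyDisjoint {d m : ℕ} {F : Type u} [TopologicalSpace F]
    {c : ℕ → ℂ} (hd : 1 ≤ d) (hc : IsOscillating d c) (hb : HasBoundedMeans c)
    {T : TorusProd m F → TorusProd m F} {q : ℕ} (hq : 0 < q) (hF : ∀ z, (T^[q] z).2 = z.2)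
    (hΔ : ∀ z, (fwdDiff 1)^[d + 1] (fun k : ℕ => ((T^[q])^[k] z).1) = 0) :
    LinearlyDisjoint c T := by
  intro x f
  change MeanZero fun n => c n * f (T^[n] x)
  have hF' : ∀ (k : ℕ) z, ((T^[q])^[k] z).2 = z.2 := by
    intro k z
    induction k with
    | zero => rfl
    | succ k ih => rw [Function.iterate_succ_apply', hF, ih]
  -- Within one residue class the orbit moves by `T^[q]`, so the finite component is frozen and only
  -- a function on the torus is left to test.
  have key : MeanZero fun n => ∑ r ∈ Finset.range q, (if n % q = r then c n else 0) *
      f (((T^[q])^[n / q] (T^[r] x)).1, (T^[r] x).2) := by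
    refine MeanZero.sum fun r hr => ?_
    let g : C(UnitAddTorus (Fin m), ℂ) := ⟨fun y => f (y, (T^[r] x).2), by fun_prop⟩
    refine MeanZero.of_dense_span (hb.indicator fun n => n % q = r)
      (fun n => ((T^[q])^[n / q] (T^[r] x)).1) UnitAddTorus.span_mFourier_closure_eq_top ?_ g
    rintro _ ⟨k, rfl⟩
    let φ : UnitAddTorus (Fin m) →+ UnitAddCircle :=
      { toFun := fun y => ∑ i, k i • y i
        map_zero' := by simp
        map_add' := fun y z => by simp [Finset.sum_add_distrib] }
    have hφ : (fwdDiff 1)^[d + 1] (fun j : ℕ => φ ((T^[q])^[j] (T^[r] x)).1) = 0 := by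
      rw [fwdDiff_iter_comp_addMonoidHom, hΔ]
      funext n
      exact map_zero φ
    obtain ⟨P, hP, hPn⟩ := exists_polynomial_of_fwdDiff_iter_eq_zero hφ
    have h := hc.meanZero_progression hd hq (Finset.mem_range.1 hr) hP
    convert h using 3 with n
    rw [← hPn, UnitAddTorus.mFourier_apply_eq]
    rfl
  convert key using 2 with n
  rw [Finset.sum_eq_single_of_mem (n % q) (Finset.mem_range.2 (Nat.mod_lt n hq))
    fun r _ hr => by rw [if_neg (Ne.symm hr), zero_mul]]
  rw [if_pos rfl, ← hF' (n / q) (T^[n % q] x), ← Function.iterate_mul, ← Function.iterate_add_apply,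
    Nat.div_add_mod]

/-! ### Lifting homomorphisms to the universal cover -/

/-- A continuous character of a real normed space lifts to a continuous linear functional. -/
theorem exists_linear_lift {E : Type*} [NormedAddCommGroup E] [NormedSpace ℝ E]
    (g : E →+ UnitAddCircle) (hg : Continuous g) :
    ∃ L : E →L[ℝ] ℝ, ∀ x, ((L x : ℝ) : UnitAddCircle) = g x := by
  obtain ⟨G, ⟨hG0, hG⟩, -⟩ := (AddCircle.isCoveringMap_coe (1 : ℝ)).existsUnique_continuousMap_lifts
    ⟨g, hg⟩ (0 : E) (0 : ℝ) (by simp)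
  have hGx : ∀ x, ((G x : ℝ) : UnitAddCircle) = g x := fun x => congrFun hG x
  have hadd : ∀ x y, G (x + y) = G x + G y := by
    intro x y
    -- The additivity defect of the lift is continuous and integer-valued on a connected space,
    -- hence constant, and it vanishes at `y = 0`.
    let D : E → ℝ := fun y => G (x + y) - G x - G y
    have hD : Continuous D := by fun_prop
    have hint : ∀ y, D y ∈ Set.range ((↑) : ℤ → ℝ) := by
      intro y
      have : ((D y : ℝ) : UnitAddCircle) = 0 := by
        simp only [D, AddCircle.coe_sub, hGx, map_add]
        abel
      obtain ⟨n, hn⟩ := AddCircle.coe_eq_zero_iff (1 : ℝ) |>.1 this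
      exact ⟨n, by simpa using hn⟩
    choose n hn using hint
    have hcont : Continuous n := by
      rw [Int.isClosedEmbedding_coe_real.isInducing.continuous_iff]
      exact hD.congr fun y => (hn y).symm
    have hconst : n y = n 0 := PreconnectedSpace.constant inferInstance hcont
    have h0 : D y = D 0 := by rw [← hn, ← hn, hconst]
    have h1 : D 0 = 0 := by simp [D, hG0]
    have h2 : G (x + y) - G x - G y = 0 := h0.trans h1
    linarith
  let G' : E →+ ℝ := { toFun := G, map_zero' := hG0, map_add' := hadd }
  exact ⟨G'.toRealLinearMap G.continuous, hGx⟩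

/-- The covering `ℝ^m → 𝕋^m`. -/
noncomputable def torusMk (m : ℕ) : (Fin m → ℝ) →+ UnitAddTorus (Fin m) where
  toFun x i := (x i : UnitAddCircle)
  map_zero' := by ext; simp
  map_add' x y := by ext; simp

@[simp] theorem torusMk_apply {m : ℕ} (x : Fin m → ℝ) (i : Fin m) :
    torusMk m x i = (x i : UnitAddCircle) := rfl

theorem continuous_torusMk (m : ℕ) : Continuous (torusMk m) :=
  continuous_pi fun i => (AddCircle.continuous_mk' (1 : ℝ)).comp (continuous_apply i)

theorem torusMk_surjective (m : ℕ) : Function.Surjective (torusMk m) := by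
  intro y
  choose x hx using fun i => QuotientAddGroup.mk_surjective (y i)
  exact ⟨x, funext hx⟩

/-- A nontrivial continuous character of the torus is surjective. -/
theorem character_surjective {m : ℕ} (ψ : UnitAddTorus (Fin m) →+ UnitAddCircle)
    (hψ : Continuous ψ) (h : ψ ≠ 0) : Function.Surjective ψ := by
  obtain ⟨L, hL⟩ := exists_linear_lift (ψ.comp (torusMk m)) (hψ.comp (continuous_torusMk m))
  have hL0 : L ≠ 0 := by
    rintro rfl
    apply h
    refine DFunLike.ext _ _ fun y => ?_
    obtain ⟨x, rfl⟩ := torusMk_surjective m y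
    simpa using (hL x).symm
  intro t
  obtain ⟨s, rfl⟩ := QuotientAddGroup.mk_surjective t
  obtain ⟨x, rfl⟩ := LinearMap.surjective (f := L.toLinearMap)
    (fun h0 => hL0 (ContinuousLinearMap.coe_injective h0)) s
  exact ⟨torusMk m x, (hL x).symm⟩

/-! ### Disjointness implies oscillation -/

/-- Prescribing a character along a nilpotent chain. -/
theorem exists_prescribed_chain {V C : Type*} [AddCommGroup V] [AddCommGroup C]
    (ν : AddMonoid.End V) (χ : V →+ C) (k : ℕ)
    (hsurj : Function.Surjective fun x => χ ((ν ^ k) x)) (hν : ν ^ (k + 1) = 0) (a : ℕ → C) :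
    ∃ x, ∀ i ≤ k, χ ((ν ^ i) x) = a i := by
  have hcomp : ∀ i j x, (ν ^ i) ((ν ^ j) x) = (ν ^ (i + j)) x := by
    intro i j x
    rw [pow_add]
    rfl
  -- The values are fixed from the top index downwards; stage `j` settles the indices `i > k - j`.
  have key : ∀ j ≤ k + 1, ∃ x, ∀ i ≤ k, k < i + j → χ ((ν ^ i) x) = a i := by
    intro j
    induction j with
    | zero => exact fun _ => ⟨0, fun i h₁ h₂ => by omega⟩
    | succ j ih =>
      intro hj
      obtain ⟨x, hx⟩ := ih (by omega)
      -- Adding `ν^j z` changes the value at `k - j` by `χ (ν^k z)`, which is arbitrary, and leaves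
      -- higher indices alone since `ν^(k+1) = 0`.
      obtain ⟨z, hz⟩ := hsurj (a (k - j) - χ ((ν ^ (k - j)) x))
      refine ⟨x + (ν ^ j) z, fun i h₁ h₂ => ?_⟩
      rw [map_add, map_add, hcomp]
      rcases Nat.lt_or_ge k (i + j) with h | h
      · obtain ⟨l, hl⟩ := Nat.exists_eq_add_of_le' (Nat.succ_le_of_lt h)
        rw [hx i h₁ h, hl, pow_add, hν, mul_zero]
        simp
      · obtain rfl : i = k - j := by omega
        have : k - j + j = k := by omega
        rw [this]
        dsimp only at hz
        rw [hz]
        abel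
  obtain ⟨x, hx⟩ := key (k + 1) le_rfl
  exact ⟨x, fun i hi => hx i hi (by omega)⟩

/-- To prove oscillation it suffices to realise every polynomial sequence of the circle along an
orbit of a system from which the sequence is disjoint. -/
theorem isOscillating_of_realization {d : ℕ} {c : ℕ → ℂ} {X : Type*} [TopologicalSpace X]
    (h : ∀ a : ℕ → UnitAddCircle, ∃ (T : X → X) (x : X) (χ : C(X, UnitAddCircle)),
      LinearlyDisjoint c T ∧ ∀ n, χ (T^[n] x) = ∑ k ∈ Finset.range (d + 1), n.choose k • a k) :
    IsOscillating d c := by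
  rw [isOscillating_iff]
  intro P hP
  obtain ⟨a, ha⟩ := Polynomial.exists_eval_eq_sum_choose hP
  obtain ⟨T, x, χ, hT, hχ⟩ := h fun k => (a k : UnitAddCircle)
  convert hT x ((fourier 1).comp χ) using 0
  change MeanZero _ ↔ MeanZero _
  refine iff_of_eq (congrArg MeanZero (funext fun n => ?_))
  rw [ContinuousMap.comp_apply, hχ, ha]
  congr 2
  exact map_sum (QuotientAddGroup.mk' (AddSubgroup.zmultiples (1 : ℝ)))
    (fun k => n.choose k • a k) (Finset.range (d + 1))

section Special

variable {m : ℕ} {F : Type u} [AddCommGroup F] [TopologicalSpace F]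

/-- An automorphism as an element of the endomorphism ring. -/
def endOfAut {X : Type*} [TopologicalSpace X] [AddCommGroup X] (A : X ≃ₜ+ X) : AddMonoid.End X :=
  A.toAddEquiv.toAddMonoidHom

theorem endOfAut_apply {X : Type*} [TopologicalSpace X] [AddCommGroup X] (A : X ≃ₜ+ X) (x : X) :
    endOfAut A x = A x := rfl

theorem subOne_apply {X : Type*} [TopologicalSpace X] [AddCommGroup X] (A : X ≃ₜ+ X) (x : X) :
    subOne A x = A x - x := rfl

/-- A nonzero endomorphism has a nonzero coordinate, which is a continuous nontrivial character. -/
theorem exists_coordinate_surjective {A : UnitAddTorus (Fin m) ≃ₜ+ UnitAddTorus (Fin m)} {k : ℕ}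
    (hA : subOne A ^ k ≠ 0) :
    ∃ i, Function.Surjective fun x => Pi.evalAddMonoidHom (fun _ : Fin m => UnitAddCircle) i
      ((subOne A ^ k) x) := by
  have hcont : Continuous (subOne A ^ k) := by
    rw [AddMonoid.End.coe_pow]
    refine Continuous.iterate ?_ k
    exact A.continuous.sub continuous_id
  by_contra! hcon
  apply hA
  ext x i
  by_contra hne
  refine hcon i (character_surjective
    ((Pi.evalAddMonoidHom (fun _ : Fin m => UnitAddCircle) i).comp (subOne A ^ k))
    ((continuous_apply i).comp hcont) fun h0 => hne ?_)
  exact DFunLike.congr_fun h0 x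

/-- The slice over `0 ∈ F` is invariant, so `B` and `C` play no role on the orbits used for
realisation. -/
theorem affineMap_iterate_special {σ : TorusProd m F ≃ₜ+ TorusProd m F}
    {A : UnitAddTorus (Fin m) ≃ₜ+ UnitAddTorus (Fin m)} {B : F →+ UnitAddTorus (Fin m)}
    {C : F ≃+ F} (hσ : ∀ x y, σ (x, y) = (A x + B y, C y)) (b x : UnitAddTorus (Fin m)) (n : ℕ) :
    (affineMap σ (b, 0))^[n] (x, 0) = ((affineMap A b)^[n] x, 0) := by
  induction n with
  | zero => rfl
  | succ n ih =>
    rw [Function.iterate_succ_apply', ih, Function.iterate_succ_apply']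
    simp [affineMap, hσ]

theorem affineMap_zero {X : Type*} [TopologicalSpace X] [AddCommGroup X] (σ : X ≃ₜ+ X) :
    affineMap σ 0 = σ := by
  ext x
  simp [affineMap]

theorem affineMap_sub_affineMap {X : Type*} [TopologicalSpace X] [AddCommGroup X] (σ : X ≃ₜ+ X)
    (b x y : X) : affineMap σ b x - affineMap σ b y =
      endOfAut σ (x - y) := by
  simp [affineMap, endOfAut_apply]

theorem fwdDiff_iter_orbit_affineMap {X : Type*} [TopologicalSpace X] [AddCommGroup X]
    (A : X ≃ₜ+ X) (b x : X) (j : ℕ) :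
    (fwdDiff 1)^[j + 1] (fun k : ℕ => (affineMap A b)^[k] x) =
      fun k : ℕ => (endOfAut A ^ k) ((subOne A ^ j) (subOne A x + b)) := by
  rw [fwdDiff_iter_orbit (affineMap_sub_affineMap A b)]
  have : affineMap A b x - x = subOne A x + b := by
    simp only [affineMap, subOne_apply]
    abel
  rw [this]
  rfl

/-- A sequence disjoint from a special automorphism of `𝕋^{d+1} × F` is oscillating. -/
theorem IsSpecial.isOscillating {d : ℕ} {c : ℕ → ℂ}
    {σ : TorusProd (d + 1) F ≃ₜ+ TorusProd (d + 1) F} (hσ : IsSpecial σ)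
    (h : LinearlyDisjoint c σ) : IsOscillating d c := by
  obtain ⟨A, B, C, hABC, hA, hA'⟩ := hσ
  obtain ⟨i, hi⟩ := exists_coordinate_surjective hA'
  refine isOscillating_of_realization (X := TorusProd (d + 1) F) fun a => ?_
  obtain ⟨x, hx⟩ := exists_prescribed_chain (subOne A) _ _ hi hA a
  let χ : C(TorusProd (d + 1) F, UnitAddCircle) := ⟨fun z => z.1 i, by fun_prop⟩
  refine ⟨σ, (x, 0), χ, h, fun n => ?_⟩
  have hiter := affineMap_iterate_special hABC 0 x n
  rw [Prod.mk_zero_zero, affineMap_zero] at hiter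
  rw [hiter]
  have hzero : (fwdDiff 1)^[d + 1] (fun k : ℕ => (affineMap A 0)^[k] x) = 0 := by
    rw [fwdDiff_iter_orbit_affineMap, add_zero]
    have : (subOne A ^ d) (subOne A x) = 0 := by
      change (subOne A ^ d * subOne A) x = 0
      rw [← pow_succ, hA]
      rfl
    rw [this]
    ext
    simp
  have hN := eq_sum_choose_of_fwdDiff_iter_eq_zero hzero n
  change Pi.evalAddMonoidHom (fun _ : Fin (d + 1) => UnitAddCircle) i _ = _
  rw [hN, map_sum]
  refine Finset.sum_congr rfl fun k hk => ?_
  rw [map_nsmul, ← hx k (Nat.lt_succ_iff.1 (Finset.mem_range.1 hk))]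
  congr 2
  cases k with
  | zero => rfl
  | succ k =>
    rw [fwdDiff_iter_orbit_affineMap, add_zero, pow_succ (subOne A)]
    rfl

/-- A sequence disjoint from all affine maps with special automorphism part is oscillating. -/
theorem IsSpecial.isOscillating_of_affineMap {d : ℕ} (hd : 1 ≤ d) {c : ℕ → ℂ}
    {σ : TorusProd d F ≃ₜ+ TorusProd d F} (hσ : IsSpecial σ)
    (h : ∀ b, LinearlyDisjoint c (affineMap σ b)) : IsOscillating d c := by
  obtain ⟨A, B, C, hABC, hA, hA'⟩ := hσ
  obtain ⟨i, hi⟩ := exists_coordinate_surjective hA'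
  have hd' : d - 1 + 1 = d := by omega
  refine isOscillating_of_realization (X := TorusProd d F) fun a => ?_
  -- With `ν = A - I`, the Newton coefficient of index `k + 1` is the `i`-th coordinate of `ν^(k+1)
  -- x + ν^k b`. Hence `x` carries only `a 0`, and `b` carries the shifted sequence.
  obtain ⟨x, hx⟩ := exists_prescribed_chain (subOne A) _ _ hi (by rwa [hd'])
    fun k => if k = 0 then a 0 else 0
  obtain ⟨b, hb⟩ := exists_prescribed_chain (subOne A) _ _ hi (by rwa [hd']) fun k => a (k + 1)
  let χ : C(TorusProd d F, UnitAddCircle) := ⟨fun z => z.1 i, by fun_prop⟩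
  refine ⟨affineMap σ (b, 0), (x, 0), χ, h _, fun n => ?_⟩
  rw [affineMap_iterate_special hABC]
  have hzero : (fwdDiff 1)^[d + 1] (fun k : ℕ => (affineMap A b)^[k] x) = 0 := by
    rw [fwdDiff_iter_orbit_affineMap, hA]
    ext
    simp
  have hN := eq_sum_choose_of_fwdDiff_iter_eq_zero hzero n
  change Pi.evalAddMonoidHom (fun _ : Fin d => UnitAddCircle) i _ = _
  rw [hN, map_sum]
  refine Finset.sum_congr rfl fun k hk => ?_
  rw [map_nsmul]
  congr 1
  have hk' := Finset.mem_range.1 hk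
  cases k with
  | zero => exact (hx 0 (by omega)).trans (if_pos rfl)
  | succ k =>
    rw [fwdDiff_iter_orbit_affineMap]
    change Pi.evalAddMonoidHom (fun _ : Fin d => UnitAddCircle) i
      ((subOne A ^ k) (subOne A x + b)) = _
    rw [map_add, map_add, hb k (by omega)]
    have : (subOne A ^ k) (subOne A x) = (subOne A ^ (k + 1)) x := by
      rw [pow_succ (subOne A)]
      rfl
    rw [this]
    rcases Nat.lt_or_ge (k + 1) d with hkd | hkd
    · rw [hx (k + 1) (by omega)]
      simp
    · obtain rfl : d = k + 1 := by omega
      rw [hA]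
      simp

end Special

/-! ### Dynamical entourages and entropy of affine maps -/

theorem discreteUniformity_of_finite (F : Type*) [Finite F] [UniformSpace F] [DiscreteTopology F] :
    DiscreteUniformity F := by
  refine ⟨unique_uniformity_of_compact (t := inferInstance) rfl ?_⟩
  exact (DiscreteTopology.eq_bot (α := F)).symm

section Basis

variable {m : ℕ} {F : Type u}

/-- Pairs with `ε`-close toral components and the same finite component. -/
def torusEntourage (m : ℕ) (F : Type u) (ε : ℝ) : SetRel (TorusProd m F) (TorusProd m F) :=
  {p | dist p.1.1 p.2.1 < ε ∧ p.1.2 = p.2.2}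

theorem mem_torusEntourage {ε : ℝ} {x y : TorusProd m F} :
    (x, y) ∈ torusEntourage m F ε ↔ dist x.1 y.1 < ε ∧ x.2 = y.2 := Iff.rfl

theorem mem_torusEntourage_iff_sub [AddCommGroup F] {ε : ℝ} {x y : TorusProd m F} :
    (x, y) ∈ torusEntourage m F ε ↔ ‖(x - y).1‖ < ε ∧ (x - y).2 = 0 := by
  rw [mem_torusEntourage, dist_eq_norm, Prod.fst_sub, Prod.snd_sub, sub_eq_zero]

variable [Finite F] [UniformSpace F] [DiscreteTopology F]

theorem hasBasis_torusEntourage :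
    (𝓤 (TorusProd m F)).HasBasis (fun ε : ℝ => 0 < ε) (torusEntourage m F) := by
  have := discreteUniformity_of_finite F
  have hF : (𝓤 F).HasBasis (fun _ : Unit => True) fun _ => SetRel.id := by
    rw [DiscreteUniformity.eq_principal_setRelId]
    exact hasBasis_principal _
  have h := (Metric.uniformity_basis_dist (α := UnitAddTorus (Fin m))).uniformity_prod hF
  refine ⟨fun t => (h.mem_iff).trans ⟨?_, ?_⟩⟩
  · rintro ⟨⟨ε, _⟩, ⟨hε, _⟩, ht⟩
    exact ⟨ε, hε, ht⟩
  · rintro ⟨ε, hε, ht⟩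
    exact ⟨(ε, ()), ⟨hε, trivial⟩, ht⟩

variable [AddCommGroup F]

-- The entourages are translation invariant, so only the orbit of `x - y` under `σ` matters and `b`
-- disappears.
omit [Finite F] [DiscreteTopology F] in
theorem mem_dynEntourage_affineMap {σ : TorusProd m F ≃ₜ+ TorusProd m F} {b : TorusProd m F}
    {ε : ℝ} {n : ℕ} {x y : TorusProd m F} :
    (x, y) ∈ Dynamics.dynEntourage (affineMap σ b) (torusEntourage m F ε) n ↔
      ∀ k < n, ‖((endOfAut σ ^ k) (x - y)).1‖ < ε ∧ ((endOfAut σ ^ k) (x - y)).2 = 0 := by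
  simp only [Dynamics.mem_dynEntourage, mem_torusEntourage_iff_sub,
    iterate_sub_iterate (affineMap_sub_affineMap σ b)]

/-- The entropy of an affine map depends only on its automorphism part. -/
theorem coverEntropy_affineMap (σ : TorusProd m F ≃ₜ+ TorusProd m F) (b b' : TorusProd m F) :
    Dynamics.coverEntropy (affineMap σ b) Set.univ =
      Dynamics.coverEntropy (affineMap σ b') Set.univ := by
  rw [Dynamics.coverEntropy_eq_iSup_basis hasBasis_torusEntourage,
    Dynamics.coverEntropy_eq_iSup_basis hasBasis_torusEntourage]
  refine iSup_congr fun ε => iSup_congr fun _ => ?_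
  have : ∀ n, Dynamics.dynEntourage (affineMap σ b) (torusEntourage m F ε) n =
      Dynamics.dynEntourage (affineMap σ b') (torusEntourage m F ε) n := by
    intro n
    ext ⟨x, y⟩
    rw [mem_dynEntourage_affineMap, mem_dynEntourage_affineMap]
  simp only [Dynamics.coverEntropyEntourage, Dynamics.coverMincard, Dynamics.IsDynCoverOf, this]

theorem HasZeroEntropy.affine {σ : TorusProd m F ≃ₜ+ TorusProd m F}
    (h : HasZeroEntropy (σ : TorusProd m F → TorusProd m F)) (b : TorusProd m F) :
    HasZeroEntropy (affineMap σ b) := by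
  rw [← affineMap_zero σ] at h
  exact (coverEntropy_affineMap σ b 0).trans h

end Basis

/-! ### Zero entropy bounds the growth of the lifted linear map -/

/-- The covering preserves the norm on the closed ball of radius `1/2`. -/
theorem le_norm_torusMk {m : ℕ} {y : Fin m → ℝ} {δ : ℝ} (hδ : 0 < δ) (h₁ : δ ≤ ‖y‖)
    (h₂ : ‖y‖ ≤ 1 / 2) : δ ≤ ‖torusMk m y‖ := by
  by_contra! h
  refine h₁.not_gt ((pi_norm_lt_iff hδ).2 fun i => ?_)
  have hi : |y i| ≤ |(1 : ℝ)| / 2 := by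
    rw [abs_one]
    exact (norm_le_pi_norm y i).trans h₂
  have := (norm_le_pi_norm (torusMk m y) i).trans_lt h
  rwa [torusMk_apply, (AddCircle.norm_coe_eq_abs_iff 1 one_ne_zero).2 hi] at this

/-- A vector stretched beyond the scale `δ` passes through a window seen by the torus. -/
theorem exists_iterate_mem_window {E : Type*} [NormedAddCommGroup E] [NormedSpace ℝ E]
    (Λ : E →L[ℝ] E) {K : ℝ} (hK : 1 ≤ K) (hΛ : ∀ y, ‖Λ y‖ ≤ K * ‖y‖) {y : E} {n : ℕ}
    (hy : ‖y‖ ≤ 1 / 2) (hn : 1 / (2 * K) ≤ ‖(Λ ^ n) y‖) :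
    ∃ j ≤ n, 1 / (2 * K) ≤ ‖(Λ ^ j) y‖ ∧ ‖(Λ ^ j) y‖ ≤ 1 / 2 := by
  classical
  have hex : ∃ j, 1 / (2 * K) ≤ ‖(Λ ^ j) y‖ := ⟨n, hn⟩
  refine ⟨Nat.find hex, Nat.find_le hn, Nat.find_spec hex, ?_⟩
  rcases h : Nat.find hex with _ | j
  · simpa using hy
  · have hlt := Nat.find_min hex (m := j) (by omega)
    push Not at hlt
    rw [pow_succ']
    calc ‖Λ ((Λ ^ j) y)‖ ≤ K * ‖(Λ ^ j) y‖ := hΛ _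
      _ ≤ K * (1 / (2 * K)) := by gcongr
      _ = 1 / 2 := by field_simp

section LowerBound

variable {m : ℕ} {F : Type u} [AddCommGroup F] [Finite F] [UniformSpace F] [DiscreteTopology F]
  {σ : TorusProd m F ≃ₜ+ TorusProd m F} {Λ : (Fin m → ℝ) →L[ℝ] (Fin m → ℝ)}

omit [Finite F] [DiscreteTopology F] in
theorem endOfAut_pow_torusMk (hΛ : ∀ x, σ (torusMk m x, 0) = (torusMk m (Λ x), 0)) (n : ℕ)
    (x : Fin m → ℝ) : (endOfAut σ ^ n) (torusMk m x, 0) = (torusMk m ((Λ ^ n) x), 0) := by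
  induction n with
  | zero => rfl
  | succ n ih =>
    rw [pow_succ', pow_succ']
    change σ ((endOfAut σ ^ n) (torusMk m x, 0)) = _
    rw [ih, hΛ]
    rfl

-- Divide the segment from `0` to `x` so that any two division points have images under `Λ^n` at
-- least `1/(2K)` apart. The torus does not see large distances, but one step stretches by at most
-- `K`, so each difference meets the window `[1/(2K), 1/2]` at some time `j ≤ n`. The dynamical
-- balls of radius `1/(4K)` are therefore disjoint, and their number bounds covers from below.
omit [Finite F] [DiscreteTopology F] in
theorem le_coverMincard (hΛ : ∀ x, σ (torusMk m x, 0) = (torusMk m (Λ x), 0)) (b : TorusProd m F)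
    {K : ℝ} (hK : 1 ≤ K) (hΛK : ∀ y, ‖Λ y‖ ≤ K * ‖y‖) {x : Fin m → ℝ} (hx : ‖x‖ ≤ 1 / 2) (n : ℕ) :
    ENNReal.ofReal ‖(Λ ^ n) x‖ ≤ ((Dynamics.coverMincard (affineMap σ b) Set.univ
      (torusEntourage m F (1 / (4 * K))) (n + 1) : ℕ∞) : ENNReal) := by
  classical
  have hK0 : 0 < K := by linarith
  -- The largest number of subdivisions keeping `‖Λ^n x‖ / L ≥ 1/(2K)`. For `L = 0` only the point
  -- `p 0` is used, and separation is vacuous.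
  let L : ℕ := ⌊2 * K * ‖(Λ ^ n) x‖⌋₊
  let p : ℕ → TorusProd m F := fun k => (torusMk m (((k : ℝ) / L) • x), 0)
  have hsep : ∀ k ≤ L, ∀ l ≤ L, k < l →
      ∃ j < n + 1, 1 / (2 * K) ≤ ‖((endOfAut σ ^ j) (p l - p k)).1‖ := by
    intro k hk l hl hkl
    have hL0 : 0 < L := by omega
    have hL0' : (0 : ℝ) < L := by exact_mod_cast hL0
    have hsub : p l - p k = (torusMk m ((((l - k : ℕ) : ℝ) / L) • x), 0) := by
      simp only [p, Prod.mk_sub_mk, ← map_sub, ← sub_smul, sub_zero]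
      rw [Nat.cast_sub hkl.le, sub_div]
    set s : ℝ := ((l - k : ℕ) : ℝ) / L with hs
    have hs0 : 0 ≤ s := by positivity
    have hs1 : s ≤ 1 := by
      rw [hs, div_le_one hL0']
      exact_mod_cast (by omega : l - k ≤ L)
    have hsL : 1 / (L : ℝ) ≤ s := by
      rw [hs]
      gcongr
      exact_mod_cast (by omega : 1 ≤ l - k)
    have hnorm : 1 / (2 * K) ≤ ‖(Λ ^ n) (s • x)‖ := by
      rw [map_smul, norm_smul, Real.norm_of_nonneg hs0]
      have hfl : (L : ℝ) ≤ 2 * K * ‖(Λ ^ n) x‖ := Nat.floor_le (by positivity)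
      calc 1 / (2 * K) = 1 / (L : ℝ) * (L / (2 * K)) := by field_simp
        _ ≤ s * ‖(Λ ^ n) x‖ := by
          gcongr
          rw [div_le_iff₀ (by positivity)]
          linarith
    have hsx : ‖s • x‖ ≤ 1 / 2 := by
      rw [norm_smul, Real.norm_of_nonneg hs0]
      calc s * ‖x‖ ≤ 1 * (1 / 2) := by gcongr
        _ = 1 / 2 := one_mul _
    obtain ⟨j, hj, h₁, h₂⟩ := exists_iterate_mem_window Λ hK hΛK hsx hnorm
    refine ⟨j, by omega, ?_⟩
    rw [hsub, endOfAut_pow_torusMk hΛ]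
    exact le_norm_torusMk (by positivity) h₁ h₂
  have hdisj : ∀ k ≤ L, ∀ l ≤ L, k < l →
      Disjoint (UniformSpace.ball (p k) (Dynamics.dynEntourage (affineMap σ b)
        (torusEntourage m F (1 / (4 * K))) (n + 1)))
        (UniformSpace.ball (p l) (Dynamics.dynEntourage (affineMap σ b)
        (torusEntourage m F (1 / (4 * K))) (n + 1))) := by
    intro k hk l hl hkl
    rw [Set.disjoint_left]
    intro z hzk hzl
    obtain ⟨j, hj, hjn⟩ := hsep k hk l hl hkl
    have h₁ := (mem_dynEntourage_affineMap.1 hzk j hj).1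
    have h₂ := (mem_dynEntourage_affineMap.1 hzl j hj).1
    have heq : p l - p k = (p l - z) - (p k - z) := by abel
    rw [heq, map_sub, Prod.fst_sub] at hjn
    have := norm_sub_le ((endOfAut σ ^ j) (p l - z)).1 ((endOfAut σ ^ j) (p k - z)).1
    have h4 : 1 / (2 * K) = 1 / (4 * K) + 1 / (4 * K) := by
      field_simp
      norm_num
    linarith
  have hdisj' : ∀ k ≤ L, ∀ l ≤ L, k ≠ l →
      Disjoint (UniformSpace.ball (p k) (Dynamics.dynEntourage (affineMap σ b)
        (torusEntourage m F (1 / (4 * K))) (n + 1)))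
        (UniformSpace.ball (p l) (Dynamics.dynEntourage (affineMap σ b)
        (torusEntourage m F (1 / (4 * K))) (n + 1))) := by
    intro k hk l hl hkl
    rcases lt_or_gt_of_ne hkl with h | h
    · exact hdisj k hk l hl h
    · exact (hdisj l hl k hk h).symm
  have hself : ∀ k, p k ∈ UniformSpace.ball (p k) (Dynamics.dynEntourage (affineMap σ b)
        (torusEntourage m F (1 / (4 * K))) (n + 1)) := by
    intro k
    refine mem_dynEntourage_affineMap.2 fun j _ => ?_
    rw [sub_self, map_zero]
    exact ⟨by simpa using hK0, rfl⟩
  have hinj : Set.InjOn p (Finset.range (L + 1)) := by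
    intro k hk l hl hkl
    by_contra hne
    have hk' : k ≤ L := by simpa [Nat.lt_succ_iff] using hk
    have hl' : l ≤ L := by simpa [Nat.lt_succ_iff] using hl
    refine Set.disjoint_left.1 (hdisj' k hk' l hl' hne) (hself k) ?_
    rw [hkl]
    exact hself l
  have hnet : Dynamics.IsDynNetIn (affineMap σ b) Set.univ (torusEntourage m F (1 / (4 * K)))
      (n + 1) ((Finset.range (L + 1)).image p : Finset (TorusProd m F)) := by
    refine ⟨Set.subset_univ _, ?_⟩
    rw [Finset.coe_image]
    rintro _ ⟨k, hk, rfl⟩ _ ⟨l, hl, rfl⟩ hne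
    have hk' : k ≤ L := by simpa [Nat.lt_succ_iff] using hk
    have hl' : l ≤ L := by simpa [Nat.lt_succ_iff] using hl
    exact hdisj' k hk' l hl' fun h => hne (by rw [h])
  have hcard := hnet.card_le_netMaxcard.trans (Dynamics.netMaxcard_le_coverMincard _ _ _)
  rw [Finset.card_image_of_injOn hinj, Finset.card_range] at hcard
  refine le_trans ?_ (ENat.toENNReal_mono hcard)
  rw [ENat.toENNReal_coe]
  refine ENNReal.ofReal_le_of_le_toReal ?_
  rw [ENNReal.toReal_natCast]
  have hfl : 2 * K * ‖(Λ ^ n) x‖ < L + 1 := Nat.lt_floor_add_one _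
  have hle : ‖(Λ ^ n) x‖ ≤ 2 * K * ‖(Λ ^ n) x‖ :=
    le_mul_of_one_le_left (norm_nonneg _) (by linarith)
  exact (hle.trans hfl.le).trans_eq (by push_cast; rfl)

/-- Zero entropy excludes exponential growth of the lifted linear map on any pair of vectors. -/
theorem HasZeroEntropy.not_exponential_growth
    (hΛ : ∀ x, σ (torusMk m x, 0) = (torusMk m (Λ x), 0)) {b : TorusProd m F}
    (h : HasZeroEntropy (affineMap σ b)) {x y : Fin m → ℝ} {ρ κ : ℝ} (hρ : 1 < ρ) (hκ : 0 < κ)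
    (hgrow : ∀ n : ℕ, κ * ρ ^ n ≤ ‖(Λ ^ n) x‖ + ‖(Λ ^ n) y‖) : False := by
  let K : ℝ := max 1 ‖Λ‖
  have hK : 1 ≤ K := le_max_left _ _
  have hK0 : 0 < K := by linarith
  have hΛK : ∀ z, ‖Λ z‖ ≤ K * ‖z‖ := fun z =>
    (Λ.le_opNorm z).trans (by gcongr; exact le_max_right _ _)
  -- This factor scales both vectors into the ball of radius `1/2`.
  let s : ℝ := 1 / (2 * (‖x‖ + ‖y‖ + 1))
  have hs : 0 < s := by positivity
  have hsmall : ∀ z : Fin m → ℝ, ‖z‖ ≤ ‖x‖ + ‖y‖ → ‖s • z‖ ≤ 1 / 2 := by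
    intro z hz
    rw [norm_smul, Real.norm_of_nonneg hs.le]
    calc s * ‖z‖ ≤ s * (‖x‖ + ‖y‖ + 1) := by gcongr; linarith
      _ = 1 / 2 := by simp only [s]; field_simp
  let u : ℕ → ENNReal := fun n => ((Dynamics.coverMincard (affineMap σ b) Set.univ
      (torusEntourage m F (1 / (4 * K))) n : ℕ∞) : ENNReal)
  have hlow : ∀ n : ℕ, ENNReal.ofReal (s * κ / 2 * ρ ^ n) ≤ u (n + 1) := by
    intro n
    -- Which vector carries the growth may depend on `n`; the cover count is bounded below either
    -- way.
    have hcase : κ * ρ ^ n / 2 ≤ ‖(Λ ^ n) x‖ ∨ κ * ρ ^ n / 2 ≤ ‖(Λ ^ n) y‖ := by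
      by_contra! hcon
      linarith [hgrow n]
    have hgen : ∀ z : Fin m → ℝ, ‖z‖ ≤ ‖x‖ + ‖y‖ → κ * ρ ^ n / 2 ≤ ‖(Λ ^ n) z‖ →
        ENNReal.ofReal (s * κ / 2 * ρ ^ n) ≤ u (n + 1) := by
      intro z hz hzn
      refine le_trans (ENNReal.ofReal_le_ofReal ?_)
        (le_coverMincard hΛ b hK hΛK (hsmall z hz) n)
      rw [map_smul, norm_smul, Real.norm_of_nonneg hs.le]
      calc s * κ / 2 * ρ ^ n = s * (κ * ρ ^ n / 2) := by ring
        _ ≤ s * ‖(Λ ^ n) z‖ := by gcongr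
    rcases hcase with h | h
    · exact hgen x (by linarith [norm_nonneg y]) h
    · exact hgen y (by linarith [norm_nonneg x]) h
  have hρ0 : 0 < ρ := by linarith
  -- The division by `ρ` absorbs the shift from `n` to `n + 1` in `hlow`.
  have hC : 0 < s * κ / 2 / ρ := by positivity
  have hgrowth : ExpGrowth.expGrowthSup (fun n => ENNReal.ofReal ρ ^ n) ≤
      ExpGrowth.expGrowthSup u := by
    refine ExpGrowth.expGrowthSup_of_eventually_ge (b := ENNReal.ofReal (s * κ / 2 / ρ)) ?_ ?_
    · simpa using hC
    · filter_upwards [eventually_ge_atTop 1] with n hn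
      obtain ⟨k, rfl⟩ := Nat.exists_eq_add_of_le' hn
      refine le_trans (le_of_eq ?_) (hlow k)
      rw [← ENNReal.ofReal_pow hρ0.le, ← ENNReal.ofReal_mul hC.le]
      congr 1
      field_simp
      ring
  have hle : ExpGrowth.expGrowthSup u ≤ 0 := by
    rw [← h]
    exact Dynamics.coverEntropyEntourage_le_coverEntropy _ _
      (hasBasis_torusEntourage.mem_of_mem (by positivity))
  have hlog := hgrowth.trans hle
  rw [ExpGrowth.expGrowthSup_pow] at hlog
  refine absurd hlog (not_le.2 ?_)
  rw [← ENNReal.log_one]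
  exact ENNReal.log_strictMono (by simpa using hρ)

end LowerBound

/-! ### Quasi-unipotence -/

/-- Kronecker's theorem for the roots of a monic integer polynomial. -/
theorem exists_pow_eq_one_of_roots_norm_le_one {p : Polynomial ℤ} (hp : p.Monic)
    (hroots : ∀ w : ℂ, Polynomial.aeval w p = 0 → ‖w‖ ≤ 1) {z : ℂ}
    (hz : Polynomial.aeval z p = 0) (hz0 : z ≠ 0) : ∃ n, 0 < n ∧ z ^ n = 1 := by
  have hint : IsIntegral ℤ z := ⟨p, hp, by rwa [← Polynomial.aeval_def]⟩
  let K := IntermediateField.adjoin ℚ {z}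
  let : NumberField K :=
    { to_charZero := (IntermediateField.adjoin ℚ {z}).charZero
      to_finiteDimensional := IntermediateField.adjoin.finiteDimensional hint.tower_top }
  let y : K := ⟨z, IntermediateField.mem_adjoin_simple_self ℚ z⟩
  suffices ∃ (n : ℕ) (_ : 0 < n), y ^ n = 1 by
    obtain ⟨n, hn₀, hn₁⟩ := this
    exact ⟨n, hn₀, congrArg (algebraMap K ℂ) hn₁⟩
  refine NumberField.Embeddings.pow_eq_one_of_norm_le_one (x := y) K ℂ (Subtype.coe_ne_coe.mp hz0)
    (IntermediateField.coe_isIntegral_iff.mp hint) fun φ => hroots _ ?_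
  -- Every conjugate of `z` is again a root of `p`, so the bound on roots covers all embeddings.
  have hy : Polynomial.aeval y p = 0 := by
    have h : algebraMap K ℂ (Polynomial.aeval y p) = 0 := by
      rw [← Polynomial.aeval_algebraMap_apply]
      exact hz
    exact (map_eq_zero_iff _ (algebraMap K ℂ).injective).1 h
  have := congrArg (φ.toIntAlgHom) hy
  rw [← Polynomial.aeval_algHom_apply, map_zero] at this
  exact this

/-- An integer matrix whose eigenvalues are nonzero and of modulus at most one has a unipotent
power. -/
theorem exists_pow_sub_one_pow_eq_zero {m : ℕ} {M : Matrix (Fin m) (Fin m) ℤ} (hM : M.det ≠ 0)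
    (hroots : ∀ w : ℂ, Polynomial.aeval w M.charpoly = 0 → ‖w‖ ≤ 1) :
    ∃ q, 0 < q ∧ (M ^ q - 1) ^ m = 0 := by
  classical
  let f : ℤ →+* ℂ := Int.castRingHom ℂ
  let p : Polynomial ℂ := M.charpoly.map f
  have hp : p.Monic := M.charpoly_monic.map f
  have hfin : ∀ z ∈ p.roots, ∃ n, 0 < n ∧ z ^ n = 1 := by
    intro z hz
    have hz' : Polynomial.aeval z M.charpoly = 0 := by
      have := Polynomial.isRoot_of_mem_roots hz
      rwa [Polynomial.IsRoot.def, Polynomial.eval_map] at this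
    refine exists_pow_eq_one_of_roots_norm_le_one M.charpoly_monic hroots hz' ?_
    rintro rfl
    have h0 : ((Polynomial.eval 0 M.charpoly : ℤ) : ℂ) = 0 := by
      rw [← hz', ← map_zero (algebraMap ℤ ℂ), Polynomial.aeval_algebraMap_apply,
        Polynomial.coe_aeval_eq_eval]
      rfl
    rw [Int.cast_eq_zero, Matrix.eval_charpoly, map_zero, zero_sub, Matrix.det_neg] at h0
    simp [hM] at h0
  choose! n hn0 hn using hfin
  let q := ∏ z ∈ p.roots.toFinset, n z
  have hq : 0 < q := Finset.prod_pos fun z hz => hn0 z (Multiset.mem_toFinset.1 hz)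
  have hroot : ∀ z ∈ p.roots, z ^ q = 1 := by
    intro z hz
    obtain ⟨k, hk⟩ := Finset.dvd_prod_of_mem n (Multiset.mem_toFinset.2 hz)
    change z ^ (∏ z ∈ p.roots.toFinset, n z) = 1
    rw [hk, pow_mul, hn z hz, one_pow]
  have hsplit : p.Splits := IsAlgClosed.splits p
  have hcard : p.roots.card = m := by
    rw [← hsplit.natDegree_eq_card_roots, M.charpoly_monic.natDegree_map,
      Matrix.charpoly_natDegree_eq_dim, Fintype.card_fin]
  -- Each of the `m` linear factors, counted with multiplicity, divides `X^q - 1`. Cayley–Hamilton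
  -- then annihilates `(M^q - 1)^m`.
  have hdvd : p ∣ (Polynomial.X ^ q - 1) ^ m := by
    conv_lhs => rw [hsplit.eq_prod_roots_of_monic hp]
    have := Multiset.prod_dvd_prod_of_dvd (S := p.roots)
      (fun x => Polynomial.X - Polynomial.C x) (fun _ => (Polynomial.X ^ q - 1 : Polynomial ℂ))
      fun z hz => by
        rw [Polynomial.dvd_iff_isRoot]
        simp [hroot z hz]
    rwa [Multiset.map_const', Multiset.prod_replicate, hcard] at this
  refine ⟨q, hq, ?_⟩
  have hzero : Polynomial.aeval (f.mapMatrix M) p = 0 := by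
    have := Matrix.aeval_self_charpoly (M.map f)
    rwa [Matrix.charpoly_map] at this
  obtain ⟨r, hr⟩ := hdvd
  have h := congrArg (Polynomial.aeval (f.mapMatrix M)) hr
  rw [map_mul, hzero, zero_mul] at h
  have h' : f.mapMatrix ((M ^ q - 1) ^ m) = 0 := by
    simpa only [map_pow, map_sub, map_one, Polynomial.aeval_X] using h
  refine Matrix.map_injective (f := f) Int.cast_injective ?_
  change f.mapMatrix _ = f.mapMatrix 0
  rw [h', map_zero]

/-- A complex eigenvalue is visible in the growth of the real and imaginary parts of an
eigenvector. -/
theorem exists_growth_of_eigenvalue {m : ℕ} {M : Matrix (Fin m) (Fin m) ℤ} {w : ℂ}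
    (hw : Polynomial.aeval w M.charpoly = 0) :
    ∃ (x y : Fin m → ℝ) (κ : ℝ), 0 < κ ∧ ∀ n : ℕ, κ * ‖w‖ ^ n ≤
      ‖((M.map ((↑) : ℤ → ℝ)) ^ n).mulVec x‖ + ‖((M.map ((↑) : ℤ → ℝ)) ^ n).mulVec y‖ := by
  let A : Matrix (Fin m) (Fin m) ℂ := M.map (Int.castRingHom ℂ)
  have hdet : (Matrix.scalar (Fin m) w - A).det = 0 := by
    rw [← Matrix.eval_charpoly, Matrix.charpoly_map, Polynomial.eval_map]
    exact hw
  obtain ⟨v, hv0, hv⟩ := Matrix.exists_mulVec_eq_zero_iff.2 hdet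
  have hAv : A.mulVec v = w • v := by
    rw [Matrix.sub_mulVec, sub_eq_zero] at hv
    rw [← hv]
    ext i
    simp [Matrix.scalar_apply, Matrix.mulVec_diagonal]
  have hpow : ∀ n : ℕ, (A ^ n).mulVec v = w ^ n • v := by
    intro n
    induction n with
    | zero => simp
    | succ n ih =>
      rw [pow_succ, ← Matrix.mulVec_mulVec, hAv, Matrix.mulVec_smul, ih, smul_smul, pow_succ']
  let x : Fin m → ℝ := fun i => (v i).re
  let y : Fin m → ℝ := fun i => (v i).im
  have hAn : ∀ n : ℕ, A ^ n = ((M.map ((↑) : ℤ → ℝ)) ^ n).map ((↑) : ℝ → ℂ) := by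
    intro n
    have h₁ := Matrix.map_pow (M.map (Int.castRingHom ℝ)) Complex.ofRealHom n
    refine Eq.trans ?_ h₁.symm
    congr 1
  refine ⟨x, y, ‖v‖, norm_pos_iff.2 hv0, fun n => ?_⟩
  have hnorm : ‖(A ^ n).mulVec v‖ = ‖v‖ * ‖w‖ ^ n := by
    rw [hpow, norm_smul, norm_pow, mul_comm]
  rw [← hnorm, pi_norm_le_iff_of_nonneg (by positivity)]
  intro i
  -- The matrix is real, so its powers act separately on the real and imaginary parts of `v`.
  have hre : ((A ^ n).mulVec v i) =
      ((((M.map ((↑) : ℤ → ℝ)) ^ n).mulVec x i : ℝ) : ℂ) +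
        ((((M.map ((↑) : ℤ → ℝ)) ^ n).mulVec y i : ℝ) : ℂ) * Complex.I := by
    rw [hAn]
    simp only [Matrix.mulVec, dotProduct, Matrix.map_apply, x, y, Complex.ofReal_sum,
      Complex.ofReal_mul, Finset.sum_mul, ← Finset.sum_add_distrib]
    refine Finset.sum_congr rfl fun j _ => ?_
    conv_lhs => rw [← Complex.re_add_im (v j)]
    ring
  rw [hre]
  refine (norm_add_le _ _).trans (add_le_add ?_ ?_)
  · rw [Complex.norm_real]
    exact norm_le_pi_norm _ i
  · rw [norm_mul, Complex.norm_I, mul_one, Complex.norm_real]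
    exact norm_le_pi_norm _ i

/-! ### Endomorphisms of the torus are integer matrices -/

/-- The linear map of `ℝ^m` defined by an integer matrix. -/
noncomputable def intMatrixCLM {m : ℕ} (M : Matrix (Fin m) (Fin m) ℤ) :
    (Fin m → ℝ) →L[ℝ] (Fin m → ℝ) :=
  LinearMap.toContinuousLinearMap (M.map ((↑) : ℤ → ℝ)).mulVecLin

theorem intMatrixCLM_apply {m : ℕ} (M : Matrix (Fin m) (Fin m) ℤ) (x : Fin m → ℝ) :
    intMatrixCLM M x = (M.map ((↑) : ℤ → ℝ)).mulVec x := rfl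

theorem intMatrixCLM_pow_apply {m : ℕ} (M : Matrix (Fin m) (Fin m) ℤ) (n : ℕ) (x : Fin m → ℝ) :
    (intMatrixCLM M ^ n) x = ((M.map ((↑) : ℤ → ℝ)) ^ n).mulVec x := by
  induction n with
  | zero => simp
  | succ n ih =>
    rw [pow_succ', pow_succ', ← Matrix.mulVec_mulVec, ← ih]
    rfl

theorem intMatrixCLM_mul {m : ℕ} (M N : Matrix (Fin m) (Fin m) ℤ) :
    intMatrixCLM (M * N) = intMatrixCLM M * intMatrixCLM N := by
  ext1 x
  change _ = intMatrixCLM M (intMatrixCLM N x)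
  simp only [intMatrixCLM_apply, Matrix.mulVec_mulVec]
  congr 1
  exact Matrix.map_mul (f := Int.castRingHom ℝ)

theorem intMatrixCLM_one {m : ℕ} : intMatrixCLM (1 : Matrix (Fin m) (Fin m) ℤ) = 1 := by
  ext1 x
  rw [intMatrixCLM_apply]
  simp

theorem intMatrixCLM_pow {m : ℕ} (M : Matrix (Fin m) (Fin m) ℤ) (n : ℕ) :
    intMatrixCLM (M ^ n) = intMatrixCLM M ^ n := by
  induction n with
  | zero => simp [intMatrixCLM_one]
  | succ n ih => rw [pow_succ, pow_succ, intMatrixCLM_mul, ih]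

theorem intMatrixCLM_sub {m : ℕ} (M N : Matrix (Fin m) (Fin m) ℤ) :
    intMatrixCLM (M - N) = intMatrixCLM M - intMatrixCLM N := by
  ext1 x
  change _ = intMatrixCLM M x - intMatrixCLM N x
  simp only [intMatrixCLM_apply, ← Matrix.sub_mulVec]
  congr 1
  ext
  simp

theorem intMatrixCLM_zero {m : ℕ} : intMatrixCLM (0 : Matrix (Fin m) (Fin m) ℤ) = 0 := by
  rw [← sub_self (0 : Matrix (Fin m) (Fin m) ℤ), intMatrixCLM_sub, sub_self]

/-- Each coordinate lifts to a linear functional; its values on the standard basis are integers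
because the basis vectors project to `0`. -/
theorem exists_intMatrix_lift {m : ℕ} (Φ : UnitAddTorus (Fin m) →+ UnitAddTorus (Fin m))
    (hΦ : Continuous Φ) : ∃ M : Matrix (Fin m) (Fin m) ℤ,
      ∀ x, torusMk m (intMatrixCLM M x) = Φ (torusMk m x) := by
  choose L hL using fun i => exists_linear_lift
    ((Pi.evalAddMonoidHom (fun _ : Fin m => UnitAddCircle) i).comp (Φ.comp (torusMk m)))
    ((continuous_apply i).comp (hΦ.comp (continuous_torusMk m)))
  have hint : ∀ i j, ∃ k : ℤ, (k : ℝ) = L i (Pi.single j 1) := by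
    intro i j
    have h1 : torusMk m (Pi.single j 1) = 0 := by
      funext l
      rw [torusMk_apply]
      by_cases h : l = j
      · subst h
        simp
      · simp [h]
    have h : ((L i (Pi.single j 1) : ℝ) : UnitAddCircle) = 0 := by
      rw [hL]
      simp only [AddMonoidHom.comp_apply, h1, map_zero]
    obtain ⟨k, hk⟩ := (AddCircle.coe_eq_zero_iff (1 : ℝ)).1 h
    exact ⟨k, by simpa using hk⟩
  choose M hM using hint
  refine ⟨Matrix.of M, fun x => ?_⟩
  funext i
  rw [torusMk_apply]
  refine Eq.trans ?_ (hL i x)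
  congr 1
  have hx : L i x = ∑ j, L i (x j • (Pi.single j 1 : Fin m → ℝ)) := by
    conv_lhs => rw [pi_eq_sum_univ' x]
    exact map_sum (L i) (fun j => x j • (Pi.single j 1 : Fin m → ℝ)) Finset.univ
  rw [hx, intMatrixCLM_apply]
  simp only [ContinuousLinearMap.map_smul, smul_eq_mul, ← hM, mul_comm (x _)]
  rfl

/-- A singular integer matrix kills an integer vector, hence a real line, whose image in the torus
is not a single point. -/
theorem intMatrix_det_ne_zero {m : ℕ} {Φ : UnitAddTorus (Fin m) →+ UnitAddTorus (Fin m)}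
    (hΦ : Function.Injective Φ) {M : Matrix (Fin m) (Fin m) ℤ}
    (hM : ∀ x, torusMk m (intMatrixCLM M x) = Φ (torusMk m x)) : M.det ≠ 0 := by
  intro hdet
  obtain ⟨v, hv0, hv⟩ := Matrix.exists_mulVec_eq_zero_iff.2 hdet
  apply hv0
  funext i
  let x : Fin m → ℝ := fun j => v j
  have hx : intMatrixCLM M x = 0 := by
    funext j
    rw [intMatrixCLM_apply]
    refine ((Int.castRingHom ℝ).map_mulVec M v j).symm.trans ?_
    rw [hv]
    simp
  have hall : ∀ t : ℝ, ((t * v i : ℝ) : UnitAddCircle) = 0 := by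
    intro t
    have h : Φ (torusMk m (t • x)) = Φ 0 := by
      rw [← hM, map_smul, hx, smul_zero, map_zero, map_zero]
    exact congrFun (hΦ h) i
  by_contra hne
  have hne' : (v i : ℝ) ≠ 0 := by exact_mod_cast hne
  have h2 := hall (1 / (2 * v i))
  rw [AddCircle.coe_eq_zero_iff] at h2
  obtain ⟨k, hk⟩ := h2
  have h3 : (k : ℝ) * 2 = 1 := by
    rw [zsmul_eq_mul, mul_one] at hk
    rw [hk]
    field_simp
  have h4 : k * 2 = 1 := by exact_mod_cast h3
  omega

/-! ### Zero-entropy affine maps of `𝕋^m × F` -/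

section Structure

variable {m : ℕ} {F : Type u} [Finite F]

/-- Some power of an affine map fixes the finite component. -/
theorem exists_iterate_snd_eq [Zero F] {T : TorusProd m F → TorusProd m F}
    (hT : Function.Surjective T) (hsnd : ∀ z z', z.2 = z'.2 → (T z).2 = (T z').2) :
    ∃ q, 0 < q ∧ ∀ z, (T^[q] z).2 = z.2 := by
  let φ : F → F := fun y => (T (0, y)).2
  have hφ : ∀ z, (T z).2 = φ z.2 := fun z => hsnd _ _ rfl
  have hsurj : Function.Surjective φ := by
    intro y
    obtain ⟨z, hz⟩ := hT (0, y)
    exact ⟨z.2, by rw [← hφ, hz]⟩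
  let e : Equiv.Perm F := Equiv.ofBijective φ (Finite.surjective_iff_bijective.1 hsurj)
  have hiter : ∀ (n : ℕ) z, (T^[n] z).2 = (e ^ n) z.2 := by
    intro n z
    induction n with
    | zero => rfl
    | succ n ih =>
      rw [Function.iterate_succ_apply', hφ, ih, pow_succ', Equiv.Perm.mul_apply]
      rfl
  refine ⟨orderOf e, orderOf_pos e, fun z => ?_⟩
  rw [hiter, pow_orderOf_eq_one]
  rfl

variable [AddCommGroup F] [UniformSpace F] [DiscreteTopology F]

-- The torus is connected and `F` is discrete.
omit [Finite F] in
theorem snd_automorphism_eq_zero (σ : TorusProd m F ≃ₜ+ TorusProd m F)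
    (x : UnitAddTorus (Fin m)) : (σ (x, 0)).2 = 0 := by
  have : ConnectedSpace (UnitAddTorus (Fin m)) :=
    (torusMk_surjective m).connectedSpace (continuous_torusMk m)
  have hcont : Continuous fun x : UnitAddTorus (Fin m) => (σ (x, 0)).2 := by fun_prop
  have h := PreconnectedSpace.constant inferInstance hcont (x := x) (y := 0)
  rw [h, Prod.mk_zero_zero, map_zero]
  rfl

omit [Finite F] in
theorem snd_affineMap_eq (σ : TorusProd m F ≃ₜ+ TorusProd m F) (b : TorusProd m F)
    {z z' : TorusProd m F} (h : z.2 = z'.2) : (affineMap σ b z).2 = (affineMap σ b z').2 := by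
  have h1 : z - z' = (z.1 - z'.1, 0) := by
    ext1
    · rfl
    · simp [h]
  have h2 : (affineMap σ b z - affineMap σ b z').2 = 0 := by
    rw [affineMap_sub_affineMap, h1]
    exact snd_automorphism_eq_zero σ _
  rwa [Prod.snd_sub, sub_eq_zero] at h2

/-- A zero-entropy affine map of `𝕋^m × F` has a power which is unipotent of order `m` and which
fixes the finite component. -/
theorem HasZeroEntropy.exists_unipotent_power (hm : m ≠ 0) {σ : TorusProd m F ≃ₜ+ TorusProd m F}
    {b : TorusProd m F} (h : HasZeroEntropy (affineMap σ b)) :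
    ∃ q, 0 < q ∧ (endOfAut σ ^ q - 1) ^ m = 0 ∧
      ∀ z, ((affineMap σ b)^[q] z).2 = z.2 := by
  let Φ : UnitAddTorus (Fin m) →+ UnitAddTorus (Fin m) :=
    { toFun := fun x => (σ (x, 0)).1
      map_zero' := by rw [Prod.mk_zero_zero, map_zero]; rfl
      map_add' := fun x y => by rw [← Prod.fst_add, ← map_add, Prod.mk_add_mk, add_zero] }
  have hσΦ : ∀ x, σ (x, 0) = (Φ x, 0) := fun x => Prod.ext rfl (snd_automorphism_eq_zero σ x)
  have hΦ : Continuous Φ := by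
    change Continuous fun x : UnitAddTorus (Fin m) => (σ (x, 0)).1
    fun_prop
  have hΦinj : Function.Injective Φ := by
    intro x y hxy
    have : σ (x, 0) = σ (y, 0) := by rw [hσΦ, hσΦ, hxy]
    exact congrArg Prod.fst (σ.injective this)
  obtain ⟨M, hM⟩ := exists_intMatrix_lift Φ hΦ
  have hlift : ∀ x, σ (torusMk m x, 0) = (torusMk m (intMatrixCLM M x), 0) := fun x => by
    rw [hσΦ, hM]
  have hroots : ∀ w : ℂ, Polynomial.aeval w M.charpoly = 0 → ‖w‖ ≤ 1 := by
    intro w hw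
    by_contra! hw1
    obtain ⟨x, y, κ, hκ, hgrow⟩ := exists_growth_of_eigenvalue hw
    refine h.not_exponential_growth hlift hw1 hκ (x := x) (y := y) fun n => ?_
    rw [intMatrixCLM_pow_apply, intMatrixCLM_pow_apply]
    exact hgrow n
  obtain ⟨q₁, hq₁, hMq⟩ := exists_pow_sub_one_pow_eq_zero (intMatrix_det_ne_zero hΦinj hM) hroots
  have hTsurj : Function.Surjective (affineMap σ b) := fun z =>
    ⟨σ.symm (z - b), by simp [affineMap]⟩
  obtain ⟨q₂, hq₂, hsnd⟩ := exists_iterate_snd_eq hTsurj fun z z' => snd_affineMap_eq σ b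
  -- `q₁` makes the toral matrix unipotent and `q₂` fixes the finite component; the product does
  -- both.
  set q := q₁ * q₂ with hq
  have hq0 : 0 < q := Nat.mul_pos hq₁ hq₂
  have hMq' : (M ^ q - 1) ^ m = 0 := by
    have hcomm : Commute (M ^ q₁ - 1) (∑ i ∈ Finset.range q₂, (M ^ q₁) ^ i) :=
      Commute.sum_right _ _ _ fun i _ =>
        (((Commute.refl (M ^ q₁)).pow_right i).sub_left (Commute.one_left _))
    rw [hq, pow_mul, ← mul_geom_sum, hcomm.mul_pow, hMq, zero_mul]
  have hsndq : ∀ (k : ℕ) z, ((affineMap σ b)^[q₂ * k] z).2 = z.2 := by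
    intro k z
    induction k with
    | zero => rfl
    | succ k ih => rw [Nat.mul_succ, Nat.add_comm, Function.iterate_add_apply, hsnd, ih]
  set ν : AddMonoid.End (TorusProd m F) := endOfAut σ ^ q - 1 with hν
  have hνtorus : ∀ (j : ℕ) (x : Fin m → ℝ),
      (ν ^ j) (torusMk m x, 0) = (torusMk m (intMatrixCLM ((M ^ q - 1) ^ j) x), 0) := by
    intro j x
    induction j with
    | zero => simp [intMatrixCLM_one]
    | succ j ih =>
      rw [pow_succ', pow_succ', intMatrixCLM_mul]
      change ν ((ν ^ j) _) = _
      rw [ih]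
      change (endOfAut σ ^ q) (torusMk m _, 0) - (torusMk m _, 0) = _
      rw [endOfAut_pow_torusMk hlift, intMatrixCLM_sub, intMatrixCLM_pow, intMatrixCLM_one,
        Prod.mk_sub_mk, ← map_sub, sub_zero, intMatrixCLM_pow M q]
      rfl
  have hνm : ∀ x : UnitAddTorus (Fin m), (ν ^ m) (x, 0) = 0 := by
    intro x
    obtain ⟨x, rfl⟩ := torusMk_surjective m x
    rw [hνtorus, hMq', intMatrixCLM_zero]
    simp
  have hνsnd : ∀ w : TorusProd m F, (ν w).2 = 0 := by
    intro w
    change ((endOfAut σ ^ q) w - w).2 = 0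
    have := iterate_sub_iterate (affineMap_sub_affineMap σ b) q w 0
    rw [sub_zero] at this
    rw [← this, Prod.snd_sub, Prod.snd_sub, hq, Nat.mul_comm, hsndq, hsndq]
    simp
  -- One application of `ν` enters the torus and `m` more kill it, so the order is a priori `m + 1`.
  -- Since `Nat.card F • w` already lies in the torus, `ν^m` is torsion, and raising to the power
  -- `Nat.card F` restores order `m`.
  have h₁ : ν ^ (m + 1) = 0 := by
    ext1 w
    rw [pow_succ]
    change (ν ^ m) (ν w) = 0
    have : ν w = ((ν w).1, 0) := Prod.ext rfl (hνsnd w)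
    rw [this, hνm]
  have h₂ : ((Nat.card F : ℕ) : AddMonoid.End (TorusProd m F)) * ν ^ m = 0 := by
    ext1 w
    change (Nat.card F : AddMonoid.End (TorusProd m F)) ((ν ^ m) w) = 0
    rw [AddMonoid.End.natCast_apply, ← map_nsmul]
    have : Nat.card F • w = (Nat.card F • w.1, 0) := by
      ext1
      · rfl
      · exact card_nsmul_eq_zero'
    rw [this, hνm]
  refine ⟨q * Nat.card F, Nat.mul_pos hq0 Nat.card_pos, ?_, fun z => ?_⟩
  · have := one_add_pow_sub_one_pow_eq_zero hm h₁ h₂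
    rwa [hν, add_sub_cancel, ← pow_mul] at this
  · rw [hq, mul_comm q₁, mul_assoc]
    exact hsndq _ z

/-- Oscillating sequences of order `m` with bounded means are disjoint from zero-entropy affine maps
of `𝕋^m × F`. -/
theorem IsOscillating.linearlyDisjoint_affineMap {c : ℕ → ℂ} (hm : 1 ≤ m) (hc : IsOscillating m c)
    (hb : HasBoundedMeans c) {σ : TorusProd m F ≃ₜ+ TorusProd m F} {b : TorusProd m F}
    (h : HasZeroEntropy (affineMap σ b)) : LinearlyDisjoint c (affineMap σ b) := by
  obtain ⟨q, hq, hσ, hF⟩ := h.exists_unipotent_power (by omega)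
  refine hc.linearlyDisjoint hm hb hq hF fun z => ?_
  have hT := iterate_sub_iterate (affineMap_sub_affineMap σ b) q
  -- The first difference is an arbitrary vector because of the translation, and `m` further ones
  -- annihilate it: order `m + 1`, degree `m`.
  have horb := fwdDiff_iter_orbit hT m z
  have := fwdDiff_iter_comp_addMonoidHom (AddMonoidHom.fst (UnitAddTorus (Fin m)) F)
    (fun k : ℕ => ((affineMap σ b)^[q])^[k] z) (m + 1)
  rw [horb, hσ] at this
  refine this.trans ?_
  funext k
  change (((endOfAut σ ^ q) ^ k) 0).1 = 0
  rw [map_zero]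
  rfl

/-- Oscillating sequences of order `d` with bounded means are disjoint from zero-entropy
automorphisms of `𝕋^{d+1} × F`. -/
theorem IsOscillating.linearlyDisjoint_automorphism {d : ℕ} {c : ℕ → ℂ} (hd : 1 ≤ d)
    (hc : IsOscillating d c) (hb : HasBoundedMeans c)
    {σ : TorusProd (d + 1) F ≃ₜ+ TorusProd (d + 1) F}
    (h : HasZeroEntropy (σ : TorusProd (d + 1) F → TorusProd (d + 1) F)) :
    LinearlyDisjoint c (σ : TorusProd (d + 1) F → TorusProd (d + 1) F) := by
  obtain ⟨q, hq, hσ, hF⟩ := (h.affine 0).exists_unipotent_power (by omega)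
  have hT := iterate_sub_iterate (affineMap_sub_affineMap σ 0) q
  rw [affineMap_zero] at hF hT
  refine hc.linearlyDisjoint hd hb hq hF fun z => ?_
  have horb := fwdDiff_iter_orbit hT d z
  have := fwdDiff_iter_comp_addMonoidHom (AddMonoidHom.fst (UnitAddTorus (Fin (d + 1))) F)
    (fun k : ℕ => ((σ : TorusProd (d + 1) F → TorusProd (d + 1) F)^[q])^[k] z) (d + 1)
  rw [horb] at this
  refine this.trans ?_
  -- Without translation the first difference already uses one factor of the nilpotent, so `d`
  -- further ones suffice.
  have hz : (σ : TorusProd (d + 1) F → TorusProd (d + 1) F)^[q] z - z =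
      (endOfAut σ ^ q - 1) z := by
    have h0 := hT z 0
    rw [sub_zero, Function.iterate_fixed (map_zero σ), sub_zero] at h0
    rw [h0]
    rfl
  have hz' : ((endOfAut σ ^ q - 1) ^ d) ((endOfAut σ ^ q - 1) z) = 0 := by
    change ((endOfAut σ ^ q - 1) ^ d * (endOfAut σ ^ q - 1)) z = 0
    rw [← pow_succ, hσ]
    rfl
  funext k
  rw [hz, hz']
  change (((endOfAut σ ^ q) ^ k) 0).1 = 0
  rw [map_zero]
  rfl

end Structure

/-! ### Polynomial growth gives zero entropy -/

/-- A polynomial is eventually below `ρ^n` for each `ρ > 1`, so the growth rate is at most `log ρ`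
for all such `ρ`. -/
theorem expGrowthSup_nonpos_of_polynomial {v : ℕ → ENNReal} {D : ℝ} {e : ℕ}
    (hD : 0 ≤ D) (h : ∀ n : ℕ, 1 ≤ n → v n ≤ ENNReal.ofReal (D * (n : ℝ) ^ e)) :
    ExpGrowth.expGrowthSup v ≤ 0 := by
  have hρ : ∀ ρ : ℝ, 1 < ρ → ExpGrowth.expGrowthSup v ≤ ENNReal.log (ENNReal.ofReal ρ) := by
    intro ρ hρ
    have hρ0 : 0 < ρ := by linarith
    rw [← ExpGrowth.expGrowthSup_pow]
    refine ExpGrowth.expGrowthSup_le_of_eventually_le (b := ENNReal.ofReal D)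
      ENNReal.ofReal_ne_top ?_
    have ht := tendsto_pow_const_div_const_pow_of_one_lt e hρ
    filter_upwards [eventually_ge_atTop 1, ht.eventually (gt_mem_nhds one_pos)] with n hn hn1
    refine (h n hn).trans ?_
    rw [← ENNReal.ofReal_pow hρ0.le, ← ENNReal.ofReal_mul hD]
    refine ENNReal.ofReal_le_ofReal ?_
    rw [div_lt_one (by positivity)] at hn1
    gcongr
  by_contra! hcon
  have h1 : (1 : ENNReal) < (ExpGrowth.expGrowthSup v).exp := by
    rw [← EReal.exp_zero]
    exact EReal.exp_strictMono hcon
  obtain ⟨ρ, -, hρ1, hρ2⟩ := ENNReal.lt_iff_exists_real_btwn.1 h1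
  have h2 := hρ ρ (by simpa using hρ1)
  have h3 := ENNReal.log_strictMono hρ2
  rw [EReal.log_exp] at h3
  exact h2.not_gt h3

section Growth

variable {m : ℕ}

theorem norm_torusMk_le (y : Fin m → ℝ) : ‖torusMk m y‖ ≤ ‖y‖ := by
  refine (pi_norm_le_iff_of_nonneg (norm_nonneg y)).2 fun i => ?_
  exact (QuotientAddGroup.norm_mk_le_norm).trans (norm_le_pi_norm y i)

/-- The grid of mesh `1 / M`. -/
theorem exists_grid (M : ℕ) (hM : 0 < M) :
    ∃ s : Finset (UnitAddTorus (Fin m)), s.card ≤ M ^ m ∧ ∀ x, ∃ p ∈ s, ‖x - p‖ ≤ 1 / M := by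
  classical
  have hM' : (0 : ℝ) < M := by exact_mod_cast hM
  let g : (Fin m → Fin M) → UnitAddTorus (Fin m) := fun κ => torusMk m fun i => (κ i : ℝ) / M
  refine ⟨Finset.univ.image g, Finset.card_image_le.trans (by simp), fun x => ?_⟩
  have hx : ∃ r : Fin m → ℝ, (∀ i, 0 ≤ r i ∧ r i < 1) ∧ torusMk m r = x := by
    obtain ⟨r, rfl⟩ := torusMk_surjective m x
    refine ⟨fun i => Int.fract (r i), fun i => ⟨Int.fract_nonneg _, Int.fract_lt_one _⟩, ?_⟩
    funext i
    rw [torusMk_apply, torusMk_apply, Int.fract, AddCircle.coe_sub, sub_eq_self,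
      AddCircle.coe_eq_zero_iff]
    exact ⟨⌊r i⌋, by simp⟩
  obtain ⟨r, hr, rfl⟩ := hx
  have hlt : ∀ i, ⌊M * r i⌋₊ < M := by
    intro i
    rw [Nat.floor_lt (mul_nonneg hM'.le (hr i).1)]
    calc (M : ℝ) * r i < M * 1 := by gcongr; exact (hr i).2
      _ = M := mul_one _
  refine ⟨g fun i => ⟨⌊M * r i⌋₊, hlt i⟩, Finset.mem_image_of_mem _ (Finset.mem_univ _), ?_⟩
  simp only [g]
  rw [← map_sub]
  refine (norm_torusMk_le _).trans ((pi_norm_le_iff_of_nonneg (by positivity)).2 fun i => ?_)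
  have h₁ := Nat.floor_le (mul_nonneg hM'.le (hr i).1)
  have h₂ := Nat.lt_floor_add_one ((M : ℝ) * r i)
  rw [Pi.sub_apply, Real.norm_eq_abs, abs_le]
  constructor
  · have : (⌊M * r i⌋₊ : ℝ) / M ≤ r i := by rw [div_le_iff₀ hM']; linarith
    have : (0 : ℝ) ≤ 1 / M := by positivity
    linarith
  · have : r i ≤ (⌊M * r i⌋₊ + 1 : ℝ) / M := by rw [le_div_iff₀ hM']; linarith
    rw [add_div] at this
    linarith

variable {F : Type u} [AddCommGroup F] [Finite F] [UniformSpace F] [DiscreteTopology F]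

/-- An automorphism with polynomial growth on the toral part has zero entropy. -/
theorem hasZeroEntropy_of_polynomial_growth {σ : TorusProd m F ≃ₜ+ TorusProd m F} {C : ℝ} {e : ℕ}
    (hC : 0 ≤ C) (h : ∀ (k : ℕ) (x : UnitAddTorus (Fin m)),
      ‖((endOfAut σ ^ k) (x, 0)).1‖ ≤ C * ((k : ℝ) + 1) ^ e * ‖x‖) :
    HasZeroEntropy (σ : TorusProd m F → TorusProd m F) := by
  classical
  have := Fintype.ofFinite F
  rw [← affineMap_zero σ]
  refine le_antisymm ?_ (Dynamics.coverEntropy_nonneg _ Set.univ_nonempty)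
  rw [Dynamics.coverEntropy_eq_iSup_basis hasBasis_torusEntourage]
  refine iSup₂_le fun ε hε => ?_
  refine expGrowthSup_nonpos_of_polynomial (D := (C / ε + 2) ^ m * Fintype.card F) (e := e * m)
    (by positivity) fun n hn => ?_
  have hn' : (1 : ℝ) ≤ n := by exact_mod_cast hn
  -- With mesh `1/M`, errors stretched by at most `C n^e` stay below `ε` up to time `n`, and `M` is
  -- still polynomial in `n`.
  set M : ℕ := ⌊C * (n : ℝ) ^ e / ε⌋₊ + 1 with hM
  have hM0 : (0 : ℝ) < M := by rw [hM]; positivity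
  have hMlow : C * (n : ℝ) ^ e / ε < M := by
    rw [hM]
    push_cast
    exact Nat.lt_floor_add_one _
  have hMup : (M : ℝ) ≤ (C / ε + 2) * (n : ℝ) ^ e := by
    have h₁ : (⌊C * (n : ℝ) ^ e / ε⌋₊ : ℝ) ≤ C * (n : ℝ) ^ e / ε := Nat.floor_le (by positivity)
    have h₂ : (1 : ℝ) ≤ (n : ℝ) ^ e := one_le_pow₀ hn'
    have h₃ : (C / ε + 2) * (n : ℝ) ^ e = C * (n : ℝ) ^ e / ε + 2 * (n : ℝ) ^ e := by ring
    rw [hM, h₃]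
    push_cast
    linarith
  obtain ⟨s, hs, hcov⟩ := exists_grid (m := m) M (Nat.succ_pos _)
  have hcover : Dynamics.IsDynCoverOf (affineMap σ 0) Set.univ (torusEntourage m F ε) n
      ((s ×ˢ Finset.univ : Finset (TorusProd m F)) : Set (TorusProd m F)) := by
    intro z _
    obtain ⟨p, hp, hzp⟩ := hcov z.1
    refine ⟨(p, z.2), by simp [hp], ?_⟩
    refine mem_dynEntourage_affineMap.2 fun k hk => ?_
    have hz : z - (p, z.2) = (z.1 - p, 0) := by
      ext1
      · rfl
      · simp
    rw [hz]
    refine ⟨(h k _).trans_lt ?_, ?_⟩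
    · have hk' : (k : ℝ) + 1 ≤ n := by exact_mod_cast hk
      calc C * ((k : ℝ) + 1) ^ e * ‖z.1 - p‖ ≤ C * (n : ℝ) ^ e * (1 / M) := by gcongr
        _ < ε := by
          rw [mul_one_div, div_lt_iff₀ hM0]
          rwa [div_lt_iff₀ hε, mul_comm (M : ℝ)] at hMlow
    · clear hz
      generalize z.1 - p = x
      induction k generalizing x with
      | zero => rfl
      | succ k ih =>
        rw [pow_succ]
        change ((endOfAut σ ^ k) (σ (x, 0))).2 = 0
        have : σ (x, 0) = ((σ (x, 0)).1, 0) := Prod.ext rfl (snd_automorphism_eq_zero σ x)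
        rw [this]
        exact ih (by omega) _
  refine (ENat.toENNReal_mono hcover.coverMincard_le_card).trans ?_
  rw [ENat.toENNReal_coe, ← ENNReal.ofReal_natCast]
  refine ENNReal.ofReal_le_ofReal ?_
  rw [Finset.card_product, Finset.card_univ]
  push_cast
  calc (s.card : ℝ) * Fintype.card F ≤ (M : ℝ) ^ m * Fintype.card F := by
        gcongr
        exact_mod_cast hs
    _ ≤ ((C / ε + 2) * (n : ℝ) ^ e) ^ m * Fintype.card F := by gcongr
    _ = (C / ε + 2) ^ m * Fintype.card F * (n : ℝ) ^ (e * m) := by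
        rw [mul_pow, pow_mul]
        ring

end Growth

/-! ### A special automorphism of zero entropy -/

/-- The automorphism `x ↦ x + ν x` for a nilpotent endomorphism `ν`. -/
noncomputable def unipotentAut {X : Type*} [TopologicalSpace X] [AddCommGroup X] [CompactSpace X]
    [T2Space X] [ContinuousAdd X] (ν : AddMonoid.End X) (hν : Continuous ν) (h : IsNilpotent ν) :
    X ≃ₜ+ X :=
  -- The algebraic inverse exists by nilpotency; its continuity comes from compactness.
  let w := h.isUnit_one_add.unit
  let e : X ≃+ X :=
    { toFun := fun x => x + ν x
      invFun := (↑w⁻¹ : AddMonoid.End X)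
      left_inv := fun x => DFunLike.congr_fun h.isUnit_one_add.val_inv_mul x
      right_inv := fun x => DFunLike.congr_fun h.isUnit_one_add.mul_val_inv x
      map_add' := fun x y => by rw [map_add]; abel }
  have he : Continuous e := continuous_id.add hν
  { e with
    continuous_toFun := he
    continuous_invFun := Continuous.continuous_symm_of_equiv_compact_to_t2 (f := e.toEquiv) he }

theorem unipotentAut_apply {X : Type*} [TopologicalSpace X] [AddCommGroup X] [CompactSpace X]
    [T2Space X] [ContinuousAdd X] (ν : AddMonoid.End X) (hν : Continuous ν) (h : IsNilpotent ν)
    (x : X) : unipotentAut ν hν h x = x + ν x := rfl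

theorem subOne_unipotentAut {X : Type*} [TopologicalSpace X] [AddCommGroup X] [CompactSpace X]
    [T2Space X] [ContinuousAdd X] (ν : AddMonoid.End X) (hν : Continuous ν) (h : IsNilpotent ν) :
    subOne (unipotentAut ν hν h) = ν := by
  ext1 x
  rw [subOne_apply, unipotentAut_apply, add_sub_cancel_left]

/-- The nilpotent shift of the coordinates of the torus. -/
def torusShift (m : ℕ) : AddMonoid.End (UnitAddTorus (Fin m)) where
  toFun x i := if 0 < i.val then x ⟨i - 1, by omega⟩ else 0
  map_zero' := by ext; simp
  map_add' x y := by
    funext i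
    simp only [Pi.add_apply]
    split_ifs <;> simp

theorem torusShift_apply {m : ℕ} (x : UnitAddTorus (Fin m)) (i : Fin m) :
    torusShift m x i = if 0 < i.val then x ⟨i - 1, by omega⟩ else 0 := rfl

theorem torusShift_pow_apply {m : ℕ} (k : ℕ) (x : UnitAddTorus (Fin m)) (i : Fin m) :
    (torusShift m ^ k) x i = if k ≤ i.val then x ⟨i - k, by omega⟩ else 0 := by
  induction k generalizing i with
  | zero => simp
  | succ k ih =>
    rw [pow_succ']
    change torusShift m ((torusShift m ^ k) x) i = _
    rw [torusShift_apply]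
    by_cases h0 : 0 < i.val
    · rw [if_pos h0, ih]
      have hiff : k ≤ i.val - 1 ↔ k + 1 ≤ i.val := by omega
      simp only [hiff]
      congr 2
      ext
      simp only
      omega
    · rw [if_neg h0, if_neg (by omega)]

theorem torusShift_pow_self (m : ℕ) : torusShift m ^ m = 0 := by
  ext x i
  rw [torusShift_pow_apply, if_neg (by omega)]
  rfl

theorem torusShift_pow_ne_zero {m : ℕ} (hm : m ≠ 0) : torusShift m ^ (m - 1) ≠ 0 := by
  intro h
  have h1 := congrFun (DFunLike.congr_fun h fun _ => ((1 / 2 : ℝ) : UnitAddCircle))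
    ⟨m - 1, by omega⟩
  rw [torusShift_pow_apply, if_pos le_rfl] at h1
  have h2 : ((1 / 2 : ℝ) : UnitAddCircle) = 0 := h1
  have h3 : ‖((1 / 2 : ℝ) : UnitAddCircle)‖ = |1 / 2| :=
    (AddCircle.norm_coe_eq_abs_iff 1 one_ne_zero).2 (by norm_num)
  rw [h2, norm_zero] at h3
  norm_num at h3

theorem norm_torusShift_pow_le {m : ℕ} (k : ℕ) (x : UnitAddTorus (Fin m)) :
    ‖(torusShift m ^ k) x‖ ≤ ‖x‖ := by
  refine (pi_norm_le_iff_of_nonneg (norm_nonneg x)).2 fun i => ?_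
  rw [torusShift_pow_apply]
  split_ifs
  · exact norm_le_pi_norm x _
  · simp

theorem continuous_torusShift (m : ℕ) : Continuous (torusShift m) := by
  refine continuous_pi fun i => ?_
  simp only [torusShift_apply]
  split_ifs
  · exact continuous_apply _
  · exact continuous_const

/-- There is a special automorphism of zero entropy of `𝕋^m × F`. -/
theorem exists_special_zeroEntropy {m : ℕ} (hm : m ≠ 0) (F : Type u) [AddCommGroup F] [Finite F]
    [UniformSpace F] [DiscreteTopology F] : ∃ σ : TorusProd m F ≃ₜ+ TorusProd m F,
      IsSpecial σ ∧ HasZeroEntropy (σ : TorusProd m F → TorusProd m F) := by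
  let A := unipotentAut (torusShift m) (continuous_torusShift m) ⟨m, torusShift_pow_self m⟩
  let σ : TorusProd m F ≃ₜ+ TorusProd m F :=
    { toFun := fun z => (A z.1, z.2)
      invFun := fun z => (A.symm z.1, z.2)
      left_inv := fun z => by simp
      right_inv := fun z => by simp
      map_add' := fun z w => by simp
      continuous_toFun := by fun_prop
      continuous_invFun := by fun_prop }
  have hσ : ∀ x y, σ (x, y) = (A x + (0 : F →+ UnitAddTorus (Fin m)) y, AddEquiv.refl F y) := by
    intro x y
    rw [AddMonoidHom.zero_apply, add_zero]
    rfl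
  have hsub : subOne A = torusShift m := subOne_unipotentAut _ _ _
  refine ⟨σ, ⟨A, 0, AddEquiv.refl F, hσ, ?_, ?_⟩, ?_⟩
  · rw [hsub, torusShift_pow_self]
  · rw [hsub]
    exact torusShift_pow_ne_zero hm
  -- Newton's formula has `m` terms, each of norm at most `(k + 1)^m * ‖x‖` because the shift does
  -- not increase the norm.
  · refine hasZeroEntropy_of_polynomial_growth (C := m) (e := m) (by positivity) fun k x => ?_
    have hA : ((endOfAut σ ^ k) (x, 0)).1 = (endOfAut A ^ k) x := by
      have h := affineMap_iterate_special hσ 0 x k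
      rw [Prod.mk_zero_zero, affineMap_zero, affineMap_zero] at h
      rw [AddMonoid.End.coe_pow, AddMonoid.End.coe_pow]
      exact congrArg Prod.fst h
    change endOfAut A - 1 = torusShift m at hsub
    have hzero : (fwdDiff 1)^[m] (fun k : ℕ => (endOfAut A ^ k) x) = 0 := by
      rw [fwdDiff_iter_end_pow, hsub, torusShift_pow_self]
      funext k
      exact map_zero (endOfAut A ^ k)
    have hN := eq_sum_choose_of_fwdDiff_iter_eq_zero hzero k
    simp only [fwdDiff_iter_end_pow, hsub] at hN
    rw [hA, hN]
    calc ‖∑ j ∈ Finset.range m, k.choose j • (endOfAut A ^ 0) ((torusShift m ^ j) x)‖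
        ≤ ∑ j ∈ Finset.range m, ((k : ℝ) + 1) ^ m * ‖x‖ := by
          refine (norm_sum_le _ _).trans (Finset.sum_le_sum fun j hj => ?_)
          refine (norm_nsmul_le).trans ?_
          have hch : (k.choose j : ℝ) ≤ ((k : ℝ) + 1) ^ m := by
            calc (k.choose j : ℝ) ≤ (k : ℝ) ^ j := by exact_mod_cast Nat.choose_le_pow k j
              _ ≤ ((k : ℝ) + 1) ^ j := by gcongr; linarith
              _ ≤ ((k : ℝ) + 1) ^ m :=
                pow_le_pow_right₀ (by linarith [Nat.cast_nonneg (α := ℝ) k])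
                  (Finset.mem_range.1 hj).le
          rw [pow_zero]
          gcongr
          exact norm_torusShift_pow_le j x
      _ = m * ((k : ℝ) + 1) ^ m * ‖x‖ := by
          rw [Finset.sum_const, Finset.card_range, nsmul_eq_mul]
          ring

/-- Each of the four disjointness conditions implies oscillation of order `d`, for every sequence;
the converse implications hold for every sequence with bounded means of absolute values. -/
theorem theorem1p1 (d : ℕ) (hd : 1 ≤ d) (c : ℕ → ℂ) :
    ((DisjointFromAutomorphisms.{u} (d + 1) c → IsOscillating d c) ∧
      (HasBoundedMeans c → IsOscillating d c → DisjointFromAutomorphisms.{u} (d + 1) c)) ∧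
    (∀ (F : Type u) [AddCommGroup F] [Finite F] [UniformSpace F] [DiscreteTopology F]
      (σ : TorusProd (d + 1) F ≃ₜ+ TorusProd (d + 1) F),
      HasZeroEntropy (σ : TorusProd (d + 1) F → TorusProd (d + 1) F) → IsSpecial σ →
        (LinearlyDisjoint c (σ : TorusProd (d + 1) F → TorusProd (d + 1) F) →
          IsOscillating d c) ∧
        (HasBoundedMeans c → IsOscillating d c →
          LinearlyDisjoint c (σ : TorusProd (d + 1) F → TorusProd (d + 1) F))) ∧
    ((DisjointFromAffineMaps.{u} d c → IsOscillating d c) ∧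
      (HasBoundedMeans c → IsOscillating d c → DisjointFromAffineMaps.{u} d c)) ∧
    (∀ (F : Type u) [AddCommGroup F] [Finite F] [UniformSpace F] [DiscreteTopology F]
      (σ : TorusProd d F ≃ₜ+ TorusProd d F),
      HasZeroEntropy (σ : TorusProd d F → TorusProd d F) → IsSpecial σ →
        (DisjointFromAffineMapsOver c σ → IsOscillating d c) ∧
        (HasBoundedMeans c → IsOscillating d c → DisjointFromAffineMapsOver c σ))
 := by
  have hd0 : d ≠ 0 := by omega
  have haut : ∀ (F : Type u) [AddCommGroup F] [Finite F] [UniformSpace F] [DiscreteTopology F]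
      (σ : TorusProd (d + 1) F ≃ₜ+ TorusProd (d + 1) F),
      HasZeroEntropy (σ : TorusProd (d + 1) F → TorusProd (d + 1) F) → HasBoundedMeans c →
        IsOscillating d c → LinearlyDisjoint c (σ : TorusProd (d + 1) F → TorusProd (d + 1) F) :=
    fun F _ _ _ _ σ hσ hb hc => hc.linearlyDisjoint_automorphism hd hb hσ
  have haff : ∀ (F : Type u) [AddCommGroup F] [Finite F] [UniformSpace F] [DiscreteTopology F]
      (σ : TorusProd d F ≃ₜ+ TorusProd d F) (b : TorusProd d F),
      HasZeroEntropy (affineMap σ b) → HasBoundedMeans c →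
        IsOscillating d c → LinearlyDisjoint c (affineMap σ b) :=
    fun F _ _ _ _ σ b hσ hb hc => hc.linearlyDisjoint_affineMap hd hb hσ
  refine ⟨⟨fun h => ?_, fun hb hc F _ _ _ _ σ hσ => haut F σ hσ hb hc⟩,
    fun F _ _ _ _ σ hσ hspec => ⟨fun h => hspec.isOscillating h, haut F σ hσ⟩,
    ⟨fun h => ?_, fun hb hc F _ _ _ _ σ b hσ => haff F σ b hσ hb hc⟩,
    fun F _ _ _ _ σ hσ hspec =>
      ⟨fun h => hspec.isOscillating_of_affineMap hd fun b => h b (hσ.affine b),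
        fun hb hc b hb' => haff F σ b hb' hb hc⟩⟩
  -- The trivial group serves as `F`: one special automorphism suffices.
  · obtain ⟨σ, hspec, hσ⟩ := exists_special_zeroEntropy d.succ_ne_zero PUnit.{u + 1}
    exact hspec.isOscillating (h _ σ hσ)
  · obtain ⟨σ, hspec, hσ⟩ := exists_special_zeroEntropy hd0 PUnit.{u + 1}
    exact hspec.isOscillating_of_affineMap hd fun b => h _ σ b (hσ.affine b)
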